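/- Let $\xi\sim P$ be a random element of a probability space. Let $f(\cdot,\xi):\mathbb R^d\to\mathbb R$ be random functions that are convex and $L_f$-smooth for every $\xi$, with $f(x):=\mathbb E[f(x,\xi)]$ finite. Let $A(\xi)$ be a random $m\times d$ matrix with $\sup_\xi\|A(\xi)\|^2<\infty$ (spectral norm), let $b(\xi)\subseteq\mathbb R^m$ be a random nonempty closed convex set, and let $\mathcal X\subset\mathbb R^d$ be convex and compact. Consider $$\min_{x\in\mathcal X} f(x)\quad\text{subject to}\quad A(\xi)x\in b(\xi)\ \text{almost surely},$$ and let $x^*$ be a solution. Assume that, for $x\in\mathcal X$, $\mathbb E[\nabla f(x,\xi)]=\nabla f(x)$ and $\mathbb E\|\nabla f(x,\xi)-\nabla f(x)\|^2\le\sigma_f^2<\infty$. Assume Slater's condition $$0\in\operatorname{sri}\bigl(\operatorname{dom} G-A\mathcal X\bigr),$$ where $\operatorname{sri}$ is the strong relative interior in $L^2(P;\mathbb R^m)$, $(Ax)(\xi)=A(\xi)x$, and $G(y)=\mathbb E[\delta_{b(\xi)}(y(\xi))]$, with $\delta_S$ equal to $0$ on $S$ and $+\infty$ off $S$. For $\beta>0$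 put $F_\beta(x,\xi)=f(x,\xi)+\frac1{2\beta}\operatorname{dist}(A(\xi)x,b(\xi))^2$. The algorithm H-1SFW, started from $x_1\in\mathcal X$, $d_0\in\mathbb R^d$ and $\beta_0>0$, performs for $k=1,2,\dots$ $$d_k=(1-\rho_k)d_{k-1}+\rho_k\nabla_xF_{\beta_k}(x_k,\xi_k),\qquad w_k=\operatorname{lmo}_{\mathcal X}(d_k)\in\arg\min_{x\in\mathcal X}\langle x,d_k\rangle,\qquad x_{k+1}=x_k+\gamma_k(w_k-x_k),$$ where $\xi_1,\xi_2,\dots$ are i.i.d. samples of $P$, $\operatorname{lmo}_{\mathcal X}$ is a measurable linear minimization oracle, $\rho_k=\frac{3}{(k+5)^{2/3}}$, $\gamma_k=\frac2{k+1}$ and $\beta_k=\frac{\beta_0}{(k+1)^{1/6}}$. Each iteration makes one call of the stochastic first-order oracle (sfo), which answers a query $(\beta,x)$ with $(F_\beta(x,\xi),\nabla_xF_\beta(x,\xi))$ for a fresh sample $\xi\sim P$, and one call of the linear minimization oracle (lmo). Then there is a constant $C$, depending only on the problem, $\beta_0$, $x_1$ and $d_0$, such that for all $k\ge1$ $$\mathbb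 E\bigl[\,|f(x_k)-f(x^*)|\,\bigr]\le C\,k^{-1/6},\qquad \sqrt{\mathbb E\bigl[\operatorname{dist}(A(\xi)x_k,b(\xi))^2\bigr]}\le C\,k^{-1/6},$$ where $\xi\sim P$ is independent of $x_k$. Consequently, for every $\varepsilon\in(0,1]$, H-1SFW produces, with at most $C\varepsilon^{-6}$ sfo calls and at most $C\varepsilon^{-6}$ lmo calls, a point $x$ with $\mathbb E[|f(x)-f(x^*)|]\le\varepsilon$ and $\sqrt{\mathbb E[\operatorname{dist}(A(\xi)x,b(\xi))^2]}\le\varepsilon$. -/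

import Mathlib

open MeasureTheory ProbabilityTheory
open scoped NNReal ENNReal Pointwise

noncomputable section

namespace HSFW

/-- The space `ℝⁿ` with its Euclidean norm. -/
abbrev Vec (n : ℕ) : Type := EuclideanSpace ℝ (Fin n)

/-! ### The problem: minimise `f(x) = E[f(x, ξ)]` over `x ∈ X` subject to `A(ξ) x ∈ b(ξ)` a.s. -/

section Problem

variable {Ξ : Type*} [MeasurableSpace Ξ] {d m : ℕ}

/-- The objective `f(x) = E[f(x, ξ)]`. -/
def objective (P : Measure Ξ) (f : Vec d → Ξ → ℝ) (x : Vec d) : ℝ :=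
  ∫ ξ, f x ξ ∂P

/-- `x` is feasible: `x ∈ X` and `A(ξ) x ∈ b(ξ)` almost surely. -/
def IsFeasible (P : Measure Ξ) (A : Ξ → Vec d →L[ℝ] Vec m) (b : Ξ → Set (Vec m))
    (X : Set (Vec d)) (x : Vec d) : Prop :=
  x ∈ X ∧ ∀ᵐ ξ ∂P, A ξ x ∈ b ξ

/-- `x` is a solution of the constrained problem. -/
def IsSolution (P : Measure Ξ) (f : Vec d → Ξ → ℝ) (A : Ξ → Vec d →L[ℝ] Vec m)
    (b : Ξ → Set (Vec m)) (X : Set (Vec d)) (x : Vec d) : Prop :=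
  IsFeasible P A b X x ∧
    ∀ y, IsFeasible P A b X y → objective P f x ≤ objective P f y

/-- The convex-analytic indicator function `δ_S`, with values `0` on `S` and `+∞` off `S`. -/
def indicatorFn {E : Type*} (S : Set E) : E → ℝ≥0∞ :=
  Set.indicator Sᶜ fun _ => ⊤

/-- The functional `G(y) = E[δ_{b(ξ)}(y(ξ))]` on the Hilbert space `L²(P; ℝᵐ)`. -/
def constraintG (P : Measure Ξ) (b : Ξ → Set (Vec m)) (y : Lp (Vec m) 2 P) : ℝ≥0∞ :=
  ∫⁻ ξ, indicatorFn (b ξ) (y ξ) ∂P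

/-- `dom G`. -/
def domG (P : Measure Ξ) (b : Ξ → Set (Vec m)) : Set (Lp (Vec m) 2 P) :=
  {y | constraintG P b y < ⊤}

/-- The image of `X` under the operator `A : ℝᵈ → L²(P; ℝᵐ)`, `(A x)(ξ) = A(ξ) x`. -/
def imageA (P : Measure Ξ) (A : Ξ → Vec d →L[ℝ] Vec m) (X : Set (Vec d)) :
    Set (Lp (Vec m) 2 P) :=
  {y | ∃ x ∈ X, y =ᵐ[P] fun ξ => A ξ x}

/-- The strong relative interior of a convex set `C`: the points `x ∈ C` at which the cone
generated by `C - x` is the closed linear span of `C - x`. -/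
def strongRelInterior {E : Type*} [NormedAddCommGroup E] [NormedSpace ℝ E] (C : Set E) : Set E :=
  {x | x ∈ C ∧ {z | ∃ t : ℝ, 0 < t ∧ ∃ y ∈ C, z = t • (y - x)} =
    ((Submodule.span ℝ ((fun y => y - x) '' C)).topologicalClosure : Set E)}

/-- The standing assumptions on the problem. -/
structure Assumptions (P : Measure Ξ) (f : Vec d → Ξ → ℝ) (A : Ξ → Vec d →L[ℝ] Vec m)
    (b : Ξ → Set (Vec m)) (X : Set (Vec d)) (Lf : ℝ≥0) (σf : ℝ) : Prop where
  /-- `f(x, ·)` is a random variable with finite expectation. -/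
  f_measurable : ∀ x, Measurable (f x)
  f_integrable : ∀ x, Integrable (f x) P
  /-- `f(·, ξ)` is convex and `L_f`-smooth. -/
  f_convex : ∀ ξ, ConvexOn ℝ Set.univ fun x => f x ξ
  f_differentiable : ∀ ξ, Differentiable ℝ fun x => f x ξ
  f_smooth : ∀ ξ, LipschitzWith Lf (gradient fun x => f x ξ)
  /-- The stochastic gradients are unbiased, with variance at most `σ_f²`. -/
  grad_unbiased : ∀ x ∈ X,
    ∫ ξ, gradient (fun y => f y ξ) x ∂P = gradient (objective P f) x
  grad_variance : ∀ x ∈ X,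
    ∫⁻ ξ, ‖gradient (fun y => f y ξ) x - gradient (objective P f) x‖ₑ ^ 2 ∂P
      ≤ ENNReal.ofReal (σf ^ 2)
  /-- The domain is convex and compact. -/
  X_convex : Convex ℝ X
  X_compact : IsCompact X
  /-- `A` is a random matrix with uniformly bounded spectral norm. -/
  A_measurable : Measurable A
  A_bounded : BddAbove (Set.range fun ξ => ‖A ξ‖ ^ 2)
  /-- `b` is a random nonempty closed convex set. -/
  b_measurable : ∀ U : Set (Vec m), IsOpen U → MeasurableSet {ξ | (b ξ ∩ U).Nonempty}
  b_nonempty : ∀ ξ, (b ξ).Nonempty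
  b_closed : ∀ ξ, IsClosed (b ξ)
  b_convex : ∀ ξ, Convex ℝ (b ξ)
  /-- Slater's condition for the problem over `X`. -/
  slater : (0 : Lp (Vec m) 2 P) ∈ strongRelInterior (domG P b - imageA P A X)

/-- The smoothed stochastic objective
`F_β(x, ξ) = f(x, ξ) + (1 / (2β)) dist(A(ξ) x, b(ξ))²`. -/
def smoothed (f : Vec d → Ξ → ℝ) (A : Ξ → Vec d →L[ℝ] Vec m) (b : Ξ → Set (Vec m))
    (β : ℝ) (x : Vec d) (ξ : Ξ) : ℝ :=
  f x ξ + 1 / (2 * β) * Metric.infDist (A ξ x) (b ξ) ^ 2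

/-- A random point `x` is an `ε`-solution, where `fstar` is the optimal value:
`E|f(x) - fstar| ≤ ε` and `E[dist(A(ξ) x, b(ξ))²]^{1/2} ≤ ε`. In the second expectation
`ξ ∼ P` is independent of `x`. -/
def IsEpsSolution (P : Measure Ξ) (f : Vec d → Ξ → ℝ) (A : Ξ → Vec d →L[ℝ] Vec m)
    (b : Ξ → Set (Vec m)) (fstar : ℝ) {Ω : Type*} [MeasurableSpace Ω] (μ : Measure Ω)
    (x : Ω → Vec d) (ε : ℝ) : Prop :=
  (Integrable (fun ω => |objective P f (x ω) - fstar|) μ ∧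
    ∫ ω, |objective P f (x ω) - fstar| ∂μ ≤ ε) ∧
  (Integrable (fun p : Ω × Ξ => Metric.infDist (A p.2 (x p.1)) (b p.2) ^ 2) (μ.prod P) ∧
    Real.sqrt (∫ p : Ω × Ξ, Metric.infDist (A p.2 (x p.1)) (b p.2) ^ 2 ∂(μ.prod P)) ≤ ε)

end Problem

/-! ### Oracles, programs that call them, and the number of calls -/

/-- `lmo` is a linear minimisation oracle of `X`: it returns a point of
`argmin_{x ∈ X} ⟨x, y⟩`. -/
def IsLMO {d : ℕ} (X : Set (Vec d)) (lmo : Vec d → Vec d) : Prop :=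
  ∀ y, lmo y ∈ X ∧ ∀ z ∈ X, inner ℝ (lmo y) y ≤ inner ℝ z y

/-- Programs with a result in `α` whose only access to the problem is through two oracles:
the stochastic first-order oracle, queried with a smoothing parameter and a point, and the
linear minimisation oracle, queried with a direction. -/
inductive OracleProg (d : ℕ) (α : Type) : Type
  | ret (a : α) : OracleProg d α
  | sfo (β : ℝ) (x : Vec d) (next : ℝ × Vec d → OracleProg d α) : OracleProg d α
  | lmo (y : Vec d) (next : Vec d → OracleProg d α) : OracleProg d α

/-- The outcome of an execution: the result and the numbers of oracle calls made. -/
structure Outcome (α : Type) where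
  result : α
  sfoCalls : ℕ
  lmoCalls : ℕ

section Run

variable {Ξ : Type*} {d m : ℕ}

/-- The answer `(F_β(x, ξ), ∇ₓF_β(x, ξ))` of the stochastic first-order oracle to the query
`(β, x)` when its sample is `ξ`. -/
def sfoAnswer (f : Vec d → Ξ → ℝ) (A : Ξ → Vec d →L[ℝ] Vec m) (b : Ξ → Set (Vec m))
    (ξ : Ξ) (β : ℝ) (x : Vec d) : ℝ × Vec d :=
  (smoothed f A b β x ξ, gradient (fun y => smoothed f A b β y ξ) x)

/-- Execution of a program. Each call of the stochastic first-order oracle consumes the next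
element of the stream `s` of samples, starting with `s i`; every call is counted. -/
def OracleProg.run {α : Type} (sfoAns : Ξ → ℝ → Vec d → ℝ × Vec d) (lmoAns : Vec d → Vec d)
    (s : ℕ → Ξ) : OracleProg d α → ℕ → Outcome α
  | .ret a, _ => ⟨a, 0, 0⟩
  | .sfo β x next, i =>
      let o := OracleProg.run sfoAns lmoAns s (next (sfoAns (s i) β x)) (i + 1)
      ⟨o.result, o.sfoCalls + 1, o.lmoCalls⟩
  | .lmo y next, i =>
      let o := OracleProg.run sfoAns lmoAns s (next (lmoAns y)) i
      ⟨o.result, o.sfoCalls, o.lmoCalls + 1⟩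

end Run

/-! ### The algorithm H-1SFW -/

/-- `ρ_k = 3 / (k + 5)^{2/3}`. -/
def rho (k : ℕ) : ℝ := 3 / ((k : ℝ) + 5) ^ (2 / 3 : ℝ)

/-- `γ_k = 2 / (k + 1)`. -/
def gam (k : ℕ) : ℝ := 2 / ((k : ℝ) + 1)

/-- `β_k = β₀ / (k + 1)^{1/6}`. -/
def betaSeq (β₀ : ℝ) (k : ℕ) : ℝ := β₀ / ((k : ℝ) + 1) ^ (1 / 6 : ℝ)

/-- `n` iterations of H-1SFW, the first of which has index `k`, from the current iterate
`x = x_k` and the previous gradient estimator `dprev = d_{k-1}`; the result is `x_{k+n}`. -/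
def h1sfwLoop {d : ℕ} (β₀ : ℝ) : ℕ → ℕ → Vec d → Vec d → OracleProg d (Vec d)
  | 0, _, x, _ => .ret x
  | n + 1, k, x, dprev =>
      .sfo (betaSeq β₀ k) x fun r =>
        let dk := (1 - rho k) • dprev + rho k • r.2
        .lmo dk fun w => h1sfwLoop β₀ n (k + 1) (x + gam k • (w - x)) dk

/-- Outcome of iterations `1, …, n` of H-1SFW from `x₁` and `d₀`; the result is `x_{n+1}`.
Iteration `k` uses the sample `s k`. -/
def h1sfw {Ξ : Type*} {d m : ℕ} (f : Vec d → Ξ → ℝ) (A : Ξ → Vec d →L[ℝ] Vec m)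
    (b : Ξ → Set (Vec m)) (lmo : Vec d → Vec d) (β₀ : ℝ) (x₁ d₀ : Vec d) (s : ℕ → Ξ) (n : ℕ) :
    Outcome (Vec d) :=
  (h1sfwLoop β₀ n 1 x₁ d₀).run (sfoAnswer f A b) lmo s 1

/-- The iterate `x_k` of H-1SFW, for `k ≥ 1`. -/
def iterate {Ξ : Type*} {d m : ℕ} (f : Vec d → Ξ → ℝ) (A : Ξ → Vec d →L[ℝ] Vec m)
    (b : Ξ → Set (Vec m)) (lmo : Vec d → Vec d) (β₀ : ℝ) (x₁ d₀ : Vec d) (s : ℕ → Ξ) (k : ℕ) :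
    Vec d :=
  (h1sfw f A b lmo β₀ x₁ d₀ s (k - 1)).result

end HSFW

end

/-! The algorithm is Frank–Wolfe on the penalised objective F_β(x) = f(x) + s(x)²/(2β), where s(x)²
= E dist(A(ξ)x, b(ξ))², with β decreasing along the run and the gradient replaced by a running
average of samples. Three estimates combine.

Gradient error. Consider d_{k-1} − ∇F_{β_k}(x_k). Averaging in a fresh sample, independent of the
current state, contracts the mean squared error by (1−ρ_k)² and adds ρ_k² times a variance of order
β_k⁻², that is O(1/k). The target then moves to ∇F_{β_{k+1}}(x_{k+1}), by O(k^{-5/6}): the point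
moves by O(1/k) under a Lipschitz constant O(1/β_k), and 1/β_k itself changes by O(k^{-5/6}).
Young's inequality with weight ρ_k turns this drift into another O(1/k). The recursion Δ ↦ (1−ρ_k)Δ
+ c/k with ρ_k ~ 3k^{-2/3} keeps Δ = O(k^{-1/3}) (`estimator_recursion`,
`Assumptions.lintegral_estimator_decay`).

Gap. A Frank–Wolfe step multiplies the gap F_β(x) − f(x*) by 1−γ_k and adds γ_k·O(k^{-1/6}), from
the first moment of the gradient error and from the curvature. Lowering β raises F_β, but the
gradient inequality towards x* gains s²/β where the gap contains only s²/(2β), and this surplus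
absorbs the change (`inner_residual_le`, `one_sub_two_gam_mul_le`,
`Assumptions.smoothedObjective_step_le`). Hence the expected gap is O(k^{-1/6})
(`Assumptions.integral_gap_le`).

Duality. Since x_k may be infeasible, f(x_k) may lie below f(x*). Slater's condition gives f(x*) −
f(x) ≤ M s(x) on X (`Assumptions.exists_objective_sub_le`), by Baire category and one convex
combination instead of multipliers. Then M s ≤ s²/(4β) + M²β spends half of the penalty; the other
half yields E s² = O(β_k k^{-1/6}) = O(k^{-1/3}), and E|f(x_k) − f(x*)| = O(k^{-1/6}) follows. -/

noncomputable section

namespace HSFW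

/-! ### Smooth convex functions -/

section Smooth

variable {E : Type*} [NormedAddCommGroup E] [InnerProductSpace ℝ E] [CompleteSpace E]

/-- The descent lemma, with a constant that is not the best possible. -/
theorem le_of_lipschitz_gradient {u : E → ℝ} {L : ℝ≥0} (hd : Differentiable ℝ u)
    (hL : LipschitzWith L (gradient u)) (x y : E) :
    u y ≤ u x + inner ℝ (gradient u x) (y - x) + L * ‖y - x‖ ^ 2 := by
  obtain ⟨z, hz, h⟩ := domain_mvt (s := Set.univ) (x := x) (y := y)
    (fun w _ => ((hd w).hasGradientAt.hasFDerivAt).hasFDerivWithinAt)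
    convex_univ trivial trivial
  rw [InnerProductSpace.toDual_apply_apply] at h
  have h1 : inner ℝ (gradient u z - gradient u x) (y - x) ≤ L * ‖y - x‖ ^ 2 := by
    have h2 : ‖z - x‖ ≤ ‖y - x‖ := by
      obtain ⟨a, b, ha, hb, hab, rfl⟩ := hz
      have : a • x + b • y - x = b • (y - x) := by
        rw [← eq_sub_iff_add_eq] at hab
        subst hab; module
      rw [this, norm_smul, Real.norm_of_nonneg hb]
      have : b ≤ 1 := by linarith
      exact mul_le_of_le_one_left (norm_nonneg _) this
    have h3 : ‖gradient u z - gradient u x‖ ≤ L * ‖z - x‖ := by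
      simpa [dist_eq_norm] using hL.dist_le_mul z x
    calc _ ≤ ‖gradient u z - gradient u x‖ * ‖y - x‖ := real_inner_le_norm _ _
      _ ≤ (L * ‖y - x‖) * ‖y - x‖ := by gcongr; exact h3.trans (by gcongr)
      _ = _ := by ring
  rw [inner_sub_left] at h1
  linarith

theorem add_inner_gradient_le {u : E → ℝ} (hc : ConvexOn ℝ Set.univ u) {x : E}
    (hd : DifferentiableAt ℝ u x) (y : E) :
    u x + inner ℝ (gradient u x) (y - x) ≤ u y := by
  have h := hd.hasGradientAt.hasFDerivAt
  have h1 := h.hasLineDerivAt (y - x)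
  rw [InnerProductSpace.toDual_apply_apply] at h1
  have hc' : ConvexOn ℝ Set.univ (fun t : ℝ => u (x + t • (y - x))) := by
    have := hc.comp_affineMap (AffineMap.lineMap x y : ℝ →ᵃ[ℝ] E)
    refine ConvexOn.congr (by simpa using this) fun t _ => ?_
    simp [AffineMap.lineMap_apply, add_comm]
  have h2 := hc'.le_slope_of_hasDerivAt (x := 0) (y := 1) trivial trivial one_pos h1
  simp only [slope_def_field, one_smul, zero_smul, add_zero, add_sub_cancel, sub_zero,
    div_one] at h2
  linarith

end Smooth

/-! ### The squared distance to a closed convex set -/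

section Dist

variable {E : Type*} [NormedAddCommGroup E] [InnerProductSpace ℝ E] [ProperSpace E]

/-- Half the gradient of the squared distance to `S`. -/
def residual (S : Set E) (y : E) : E :=
  (1 / 2 : ℝ) • gradient (fun z => Metric.infDist z S ^ 2) y

variable {S : Set E} (hne : S.Nonempty) (hcl : IsClosed S) (hcv : Convex ℝ S)
include hne hcl hcv

theorem exists_projection (y : E) :
    ∃ p ∈ S, Metric.infDist y S = ‖y - p‖ ∧ ∀ w ∈ S, inner ℝ (y - p) (w - p) ≤ 0 := by
  obtain ⟨p, hp, h⟩ := hcl.exists_infDist_eq_dist hne y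
  rw [dist_eq_norm] at h
  refine ⟨p, hp, h, (norm_eq_iInf_iff_real_inner_le_zero hcv hp).1 ?_⟩
  have := hne.to_subtype
  refine le_antisymm (le_ciInf fun w => ?_) (ciInf_le ⟨0, ?_⟩ (⟨p, hp⟩ : S))
  · rw [← h, ← dist_eq_norm]; exact Metric.infDist_le_dist_of_mem w.2
  · rintro _ ⟨w, rfl⟩; positivity

/-- The lower bound combines the variational inequality at `p` with the square of the difference of
the residuals at `z` and `y`; the upper bound uses `p` as a competitor for `z`. Together they give
differentiability, convexity and smoothness of the squared distance. -/
theorem sq_infDist_bounds_of_projection {y p : E} (hp : p ∈ S)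
    (h : Metric.infDist y S = ‖y - p‖) (hi : ∀ w ∈ S, inner ℝ (y - p) (w - p) ≤ 0) (z : E) :
    Metric.infDist y S ^ 2 + 2 * inner ℝ (y - p) (z - y) ≤ Metric.infDist z S ^ 2 ∧
    Metric.infDist z S ^ 2 ≤
      Metric.infDist y S ^ 2 + 2 * inner ℝ (y - p) (z - y) + ‖z - y‖ ^ 2 := by
  constructor
  · obtain ⟨w, hw, hzw, -⟩ := exists_projection hne hcl hcv z
    rw [hzw, h]
    have h1 := hi w hw
    have h2 : inner ℝ (y - p) (z - w) =
        inner ℝ (y - p) (z - y) + ‖y - p‖ ^ 2 - inner ℝ (y - p) (w - p) := by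
      rw [← real_inner_self_eq_norm_sq, ← inner_add_right, ← inner_sub_right]
      congr 1; abel
    have h3 := sq_nonneg ‖(z - w) - (y - p)‖
    rw [norm_sub_sq_real, real_inner_comm] at h3
    linarith
  · have h1 : Metric.infDist z S ≤ ‖z - p‖ := by
      rw [← dist_eq_norm]; exact Metric.infDist_le_dist_of_mem hp
    have h2 : ‖z - p‖ ^ 2 = ‖y - p‖ ^ 2 + 2 * inner ℝ (y - p) (z - y) + ‖z - y‖ ^ 2 := by
      rw [← norm_add_sq_real]; congr 2; abel
    have h3 := Metric.infDist_nonneg (x := z) (s := S)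
    rw [h, ← h2]
    gcongr

theorem hasGradientAt_of_projection {y p : E} (hp : p ∈ S)
    (h : Metric.infDist y S = ‖y - p‖) (hi : ∀ w ∈ S, inner ℝ (y - p) (w - p) ≤ 0) :
    HasGradientAt (fun z => Metric.infDist z S ^ 2) ((2 : ℝ) • (y - p)) y := by
  rw [hasGradientAt_iff_isLittleO]
  have h1 : (fun z => ‖z - y‖ ^ 2) =o[nhds y] fun z => z - y := by
    have h0 : Filter.Tendsto (fun z : E => z - y) (nhds y) (nhds 0) := by
      have : Continuous fun z : E => z - y := by fun_prop
      simpa using this.tendsto y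
    exact (Asymptotics.isLittleO_norm_pow_id one_lt_two).comp_tendsto h0
  refine Asymptotics.IsBigO.trans_isLittleO (Asymptotics.IsBigO.of_bound 1 ?_) h1
  refine Filter.Eventually.of_forall fun z => ?_
  obtain ⟨ha, hb⟩ := sq_infDist_bounds_of_projection hne hcl hcv hp h hi z
  rw [inner_smul_left, Real.norm_eq_abs, Real.norm_of_nonneg (by positivity), abs_le]
  simp only [conj_trivial]
  constructor <;> nlinarith [sq_nonneg ‖z - y‖]

theorem residual_spec (y : E) :
    y - residual S y ∈ S ∧ Metric.infDist y S = ‖residual S y‖ ∧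
      ∀ w ∈ S, inner ℝ (residual S y) (w - (y - residual S y)) ≤ 0 := by
  obtain ⟨p, hp, h, hi⟩ := exists_projection hne hcl hcv y
  have hr : residual S y = y - p := by
    rw [residual, (hasGradientAt_of_projection hne hcl hcv hp h hi).gradient, smul_smul]
    norm_num
  rw [hr, sub_sub_cancel]
  exact ⟨hp, h, hi⟩

theorem hasGradientAt_sq_infDist (y : E) :
    HasGradientAt (fun z => Metric.infDist z S ^ 2) ((2 : ℝ) • residual S y) y := by
  obtain ⟨hp, h, hi⟩ := residual_spec hne hcl hcv y
  have := hasGradientAt_of_projection hne hcl hcv (y := y) hp (by rwa [sub_sub_cancel])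
    (by simpa using hi)
  rwa [sub_sub_cancel] at this

theorem sq_infDist_bounds (y z : E) :
    Metric.infDist y S ^ 2 + 2 * inner ℝ (residual S y) (z - y) ≤ Metric.infDist z S ^ 2 ∧
    Metric.infDist z S ^ 2 ≤
      Metric.infDist y S ^ 2 + 2 * inner ℝ (residual S y) (z - y) + ‖z - y‖ ^ 2 := by
  obtain ⟨hp, h, hi⟩ := residual_spec hne hcl hcv y
  have := sq_infDist_bounds_of_projection hne hcl hcv (y := y) hp (by rwa [sub_sub_cancel])
    (by simpa using hi) z
  rwa [sub_sub_cancel] at this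

/-- Convexity of half the squared distance would give only half of the right-hand side. The full
square comes from the variational inequality, and the extra half later pays for the decrease of `β`.
-/
theorem inner_residual_le {y w : E} (hw : w ∈ S) :
    inner ℝ (residual S y) (w - y) ≤ -Metric.infDist y S ^ 2 := by
  obtain ⟨-, h, hi⟩ := residual_spec hne hcl hcv y
  have := hi w hw
  rw [sub_sub_eq_add_sub, add_sub_right_comm, inner_add_right, real_inner_self_eq_norm_sq] at this
  rw [h]; linarith

/-- Adding the two variational inequalities, each tested at the other projection, shows that the
residual map is firmly nonexpansive. -/
theorem norm_residual_sub_le (y z : E) : ‖residual S y - residual S z‖ ≤ ‖y - z‖ := by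
  obtain ⟨hp, -, hi⟩ := residual_spec hne hcl hcv y
  obtain ⟨hq, -, hj⟩ := residual_spec hne hcl hcv z
  have h1 := hi _ hq
  have h2 := hj _ hp
  set r := residual S y
  set s := residual S z
  have h3 : inner ℝ (r - s) (r - s) ≤ inner ℝ (r - s) (y - z) := by
    have e : inner ℝ (r - s) (y - z) - inner ℝ (r - s) (r - s)
        = -(inner ℝ r (z - s - (y - r)) + inner ℝ s (y - r - (z - s))) := by
      rw [← inner_sub_right, ← neg_sub (z - s) (y - r), inner_neg_right, ← sub_eq_add_neg,
        ← inner_sub_left, ← inner_neg_right]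
      congr 1; abel
    linarith
  have h4 := h3.trans (real_inner_le_norm _ _)
  rw [real_inner_self_eq_norm_sq] at h4
  by_contra! hlt
  nlinarith [norm_nonneg (y - z)]

end Dist

/-! ### Measurability -/

section Measurability

variable {Ξ : Type*} [MeasurableSpace Ξ] {d m : ℕ}

theorem measurable_vec {α : Type*} [MeasurableSpace α] {n : ℕ} {g : α → Vec n}
    (h : ∀ v : Vec n, Measurable fun a => inner ℝ (g a) v) : Measurable g := by
  have h1 : Measurable fun a => WithLp.ofLp (g a) := by
    refine measurable_pi_lambda _ fun i => ?_
    convert h (EuclideanSpace.single i 1) using 2 with a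
    simp [EuclideanSpace.inner_single_right]
  exact (WithLp.measurable_toLp 2 _).comp h1

/-- Each component is a pointwise limit of difference quotients with increments `1/n`. -/
theorem measurable_gradient_param {u : Vec d → Ξ → ℝ} (hm : ∀ x, Measurable (u x))
    (hd : ∀ ξ, Differentiable ℝ fun x => u x ξ) (x : Vec d) :
    Measurable fun ξ => gradient (fun y => u y ξ) x := by
  refine measurable_vec fun v => ?_
  refine measurable_of_tendsto_metrizable
    (f := fun (n : ℕ) ξ => (n : ℝ) * (u (x + (n : ℝ)⁻¹ • v) ξ - u x ξ))
    (fun n => ((hm _).sub (hm _)).const_mul _) ?_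
  rw [tendsto_pi_nhds]
  intro ξ
  have h := ((hd ξ x).hasGradientAt.hasFDerivAt.lim_real v).comp tendsto_natCast_atTop_atTop
  rw [InnerProductSpace.toDual_apply_apply] at h
  exact h

theorem measurable_infDist_randomSet {b : Ξ → Set (Vec m)}
    (hb : ∀ U : Set (Vec m), IsOpen U → MeasurableSet {ξ | (b ξ ∩ U).Nonempty})
    (hne : ∀ ξ, (b ξ).Nonempty) : Measurable fun p : Vec m × Ξ => Metric.infDist p.1 (b p.2) := by
  refine measurable_uncurry_of_continuous_of_measurable
    (u := fun (y : Vec m) (ξ : Ξ) => Metric.infDist y (b ξ))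
    (fun ξ => Metric.continuous_infDist_pt _) fun y => ?_
  refine measurable_of_Iio fun r => ?_
  -- The distance is below `r` exactly when the random set hits the open ball of radius `r`, which
  -- is an event by the definition of a random set.
  convert hb (Metric.ball y r) Metric.isOpen_ball using 1
  ext ξ
  simp only [Set.mem_preimage, Set.mem_Iio, Metric.infDist_lt_iff (hne ξ), Set.mem_ofPred_eq]
  simp [Set.Nonempty, Metric.mem_ball, dist_comm]

theorem measurable_apply_uncurry {A : Ξ → Vec d →L[ℝ] Vec m} (hA : Measurable A) :
    Measurable fun p : Vec d × Ξ => A p.2 p.1 :=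
  measurable_uncurry_of_continuous_of_measurable (u := fun (x : Vec d) (ξ : Ξ) => A ξ x)
    (fun ξ => (A ξ).continuous) fun x => (ContinuousLinearMap.measurable_apply x).comp hA

end Measurability

/-! ### Strong relative interior and Slater's condition -/

/-- Baire category: the closed subspace generated by `C` is the union of the closed sets of its
vectors lying in `(n+1)C`, so one of these contains a ball, which convexity moves to the origin. The
conclusion includes negative `s`, which is what the duality argument needs. -/
theorem exists_radius_of_zero_mem_strongRelInterior {E : Type*} [NormedAddCommGroup E]
    [NormedSpace ℝ E] [CompleteSpace E] {C : Set E} (hcl : IsClosed C) (hcv : Convex ℝ C)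
    (h0 : (0 : E) ∈ strongRelInterior C) :
    ∃ r : ℝ, 0 < r ∧ ∀ u ∈ C, ∀ s : ℝ, ‖s • u‖ ≤ r → s • u ∈ C := by
  obtain ⟨hC, hV⟩ := h0
  set V := (Submodule.span ℝ ((fun y => y - 0) '' C)).topologicalClosure with hVdef
  have hcone : ∀ v : E, v ∈ V ↔ ∃ t : ℝ, 0 < t ∧ ∃ y ∈ C, v = t • y := by
    intro v
    rw [← SetLike.mem_coe, ← hV]
    simp
  have hVc : IsClosed (V : Set E) := Submodule.isClosed_topologicalClosure _
  have : CompleteSpace V := hVc.completeSpace_coe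
  let F : ℕ → Set V := fun n => {v | ((n : ℝ) + 1)⁻¹ • (v : E) ∈ C}
  have hF : ∀ n, IsClosed (F n) := fun n =>
    hcl.preimage (by fun_prop : Continuous fun v : V => ((n : ℝ) + 1)⁻¹ • (v : E))
  have hU : ⋃ n, F n = Set.univ := by
    refine Set.eq_univ_of_forall fun v => Set.mem_iUnion.2 ?_
    obtain ⟨t, ht, y, hy, hv⟩ := (hcone v).1 v.2
    obtain ⟨n, hn⟩ := exists_nat_ge t
    refine ⟨n, ?_⟩
    change ((n : ℝ) + 1)⁻¹ • (v : E) ∈ C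
    rw [hv, smul_smul]
    refine hcv.smul_mem_of_zero_mem hC hy ⟨by positivity, ?_⟩
    rw [inv_mul_le_iff₀ (by positivity)]
    linarith
  obtain ⟨n, c, hc⟩ := nonempty_interior_of_iUnion_of_closed hF hU
  obtain ⟨ε, hε, hball⟩ := Metric.isOpen_iff.1 isOpen_interior c hc
  -- The cone is a subspace, so it contains `-c`. Mixing `(c + w)/N` with `y = -c/t`, with weights
  -- `N/(N+t)` and `t/(N+t)`, cancels the centre and leaves `w/(N+t)`.
  obtain ⟨t, ht, y, hy, hcy⟩ := (hcone (-c : V)).1 (-c : V).2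
  set N : ℝ := (n : ℝ) + 1
  have hN : 0 < N := by positivity
  have key : ∀ w ∈ V, ‖w‖ < ε → (N + t)⁻¹ • w ∈ C := by
    intro w hw hwε
    have h1 : c + ⟨w, hw⟩ ∈ F n := interior_subset (hball (by simpa [dist_eq_norm] using hwε))
    have h2 : N⁻¹ • ((c : E) + w) ∈ C := h1
    have h3 := hcv h2 hy (a := N / (N + t)) (b := t / (N + t)) (by positivity) (by positivity)
      (by field_simp)
    convert h3 using 1
    have h4 : (c : E) = -(t • y) := by rw [← hcy]; simp
    rw [h4]
    match_scalars
    · field_simp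
    · field_simp
      ring
  refine ⟨ε / (2 * (N + t)), by positivity, fun u hu s hs => ?_⟩
  have h5 := key ((N + t) • s • u)
    (V.smul_mem _ (V.smul_mem _ ((hcone u).2 ⟨1, one_pos, u, hu, (one_smul _ _).symm⟩))) ?_
  · rwa [smul_smul, inv_mul_cancel₀ (by positivity), one_smul] at h5
  · rw [norm_smul, Real.norm_of_nonneg (by positivity)]
    calc (N + t) * ‖s • u‖ ≤ (N + t) * (ε / (2 * (N + t))) := by gcongr
      _ = ε / 2 := by field_simp
      _ < ε := by linarith

/-! ### The constraint set in L² and the lower bound on the objective under Slater's condition -/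

section Problem

variable {Ξ : Type*} [MeasurableSpace Ξ] {P : Measure Ξ} {d m : ℕ}
  {f : Vec d → Ξ → ℝ} {A : Ξ → Vec d →L[ℝ] Vec m} {b : Ξ → Set (Vec m)} {X : Set (Vec d)}
  {Lf : ℝ≥0} {σf : ℝ}

theorem Assumptions.exists_norm_le (h : Assumptions P f A b X Lf σf) :
    ∃ a : ℝ, 0 ≤ a ∧ ∀ ξ, ‖A ξ‖ ≤ a := by
  obtain ⟨B, hB⟩ := h.A_bounded
  refine ⟨√B, Real.sqrt_nonneg _, fun ξ => Real.le_sqrt_of_sq_le (hB ⟨ξ, rfl⟩)⟩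

theorem Assumptions.measurable_infDist (h : Assumptions P f A b X Lf σf) :
    Measurable fun p : Vec m × Ξ => Metric.infDist p.1 (b p.2) :=
  measurable_infDist_randomSet h.b_measurable h.b_nonempty

theorem Assumptions.measurable_infDist_comp (h : Assumptions P f A b X Lf σf) {α : Type*}
    [MeasurableSpace α] {y : α → Vec m} {ζ : α → Ξ} (hy : Measurable y) (hζ : Measurable ζ) :
    Measurable fun a => Metric.infDist (y a) (b (ζ a)) := by
  have := Measurable.comp (g := fun p : Vec m × Ξ => Metric.infDist p.1 (b p.2))
    (f := fun a => (y a, ζ a)) h.measurable_infDist (hy.prodMk hζ)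
  exact this

/-- Defining the residual as a gradient pays off here: it is a limit of measurable difference
quotients in `ξ` and continuous in the point, so no measurable selection of projections is required.
-/
theorem Assumptions.measurable_residual (h : Assumptions P f A b X Lf σf) :
    Measurable fun p : Vec m × Ξ => residual (b p.2) p.1 := by
  refine measurable_uncurry_of_continuous_of_measurable
    (u := fun (y : Vec m) (ξ : Ξ) => residual (b ξ) y) (fun ξ => ?_) fun y => ?_
  · refine (LipschitzWith.of_dist_le_mul (K := 1) fun y z => ?_).continuous
    simpa [dist_eq_norm] using
      norm_residual_sub_le (h.b_nonempty ξ) (h.b_closed ξ) (h.b_convex ξ) y z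
  · refine Measurable.const_smul (measurable_gradient_param
      (u := fun y ξ => Metric.infDist y (b ξ) ^ 2) (fun x => ?_) (fun ξ z => ?_) y) (1 / 2 : ℝ)
    · exact (h.measurable_infDist_comp measurable_const measurable_id).pow_const 2
    · exact (hasGradientAt_sq_infDist (h.b_nonempty ξ) (h.b_closed ξ)
        (h.b_convex ξ) z).differentiableAt

theorem Assumptions.measurable_residual_comp (h : Assumptions P f A b X Lf σf) {α : Type*}
    [MeasurableSpace α] {y : α → Vec m} {ζ : α → Ξ} (hy : Measurable y) (hζ : Measurable ζ) :
    Measurable fun a => residual (b (ζ a)) (y a) := by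
  have := Measurable.comp (g := fun p : Vec m × Ξ => residual (b p.2) p.1)
    (f := fun a => (y a, ζ a)) h.measurable_residual (hy.prodMk hζ)
  exact this

theorem Assumptions.measurable_apply (h : Assumptions P f A b X Lf σf) (x : Vec d) :
    Measurable fun ξ => A ξ x :=
  (ContinuousLinearMap.measurable_apply x).comp h.A_measurable

theorem Assumptions.measurable_residual_apply (h : Assumptions P f A b X Lf σf) (x : Vec d) :
    Measurable fun ξ => residual (b ξ) (A ξ x) :=
  h.measurable_residual_comp (h.measurable_apply x) measurable_id

theorem Assumptions.norm_residual_eq (h : Assumptions P f A b X Lf σf) (ξ : Ξ) (y : Vec m) :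
    ‖residual (b ξ) y‖ = Metric.infDist y (b ξ) :=
  (residual_spec (h.b_nonempty ξ) (h.b_closed ξ) (h.b_convex ξ) y).2.1.symm

omit [MeasurableSpace Ξ] in
theorem infDist_apply_le {a : ℝ} (ha : ∀ ξ, ‖A ξ‖ ≤ a) {ξ : Ξ}
    {z : Vec d} (hz : A ξ z ∈ b ξ) (x : Vec d) :
    Metric.infDist (A ξ x) (b ξ) ≤ a * ‖x - z‖ := by
  refine (Metric.infDist_le_dist_of_mem hz).trans ?_
  rw [dist_eq_norm, ← map_sub]
  exact (A ξ).le_of_opNorm_le (ha ξ) _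

variable [IsProbabilityMeasure P]

theorem Assumptions.memLp_apply (h : Assumptions P f A b X Lf σf) (x : Vec d) :
    MemLp (fun ξ => A ξ x) 2 P := by
  obtain ⟨a, -, ha⟩ := h.exists_norm_le
  exact MemLp.of_bound (h.measurable_apply x).aestronglyMeasurable (a * ‖x‖)
    (Filter.Eventually.of_forall fun ξ => (A ξ).le_of_opNorm_le (ha ξ) x)

theorem Assumptions.memLp_residual (h : Assumptions P f A b X Lf σf) {z : Vec d}
    (hz : ∀ᵐ ξ ∂P, A ξ z ∈ b ξ) (x : Vec d) :
    MemLp (fun ξ => residual (b ξ) (A ξ x)) 2 P := by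
  obtain ⟨a, -, ha⟩ := h.exists_norm_le
  refine MemLp.of_bound (h.measurable_residual_apply x).aestronglyMeasurable (a * ‖x - z‖) ?_
  filter_upwards [hz] with ξ hξ
  rw [h.norm_residual_eq]
  exact infDist_apply_le ha hξ x

/-- The operator `A : ℝᵈ → L²(P; ℝᵐ)`. -/
def Assumptions.operator (h : Assumptions P f A b X Lf σf) : Vec d →ₗ[ℝ] Lp (Vec m) 2 P where
  toFun x := (h.memLp_apply x).toLp
  map_add' x y := by
    rw [← MemLp.toLp_add]
    exact MemLp.toLp_congr _ _ (Filter.Eventually.of_forall fun ξ => by simp)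
  map_smul' c x := by
    rw [RingHom.id_apply, ← MemLp.toLp_const_smul]
    exact MemLp.toLp_congr _ _ (Filter.Eventually.of_forall fun ξ => by simp)

theorem Assumptions.coeFn_operator (h : Assumptions P f A b X Lf σf) (x : Vec d) :
    h.operator x =ᵐ[P] fun ξ => A ξ x := (h.memLp_apply x).coeFn_toLp

theorem Assumptions.imageA_eq (h : Assumptions P f A b X Lf σf) :
    imageA P A X = h.operator '' X := by
  ext y
  constructor
  · rintro ⟨x, hx, hy⟩
    exact ⟨x, hx, Lp.ext ((h.coeFn_operator x).trans hy.symm)⟩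
  · rintro ⟨x, hx, rfl⟩
    exact ⟨x, hx, h.coeFn_operator x⟩

omit [IsProbabilityMeasure P] in
-- The integrand takes only the values `0` and `⊤`, so its integral is finite exactly when the
-- violation event, which is measurable, is null.
theorem Assumptions.mem_domG_iff (h : Assumptions P f A b X Lf σf) (y : Lp (Vec m) 2 P) :
    y ∈ domG P b ↔ ∀ᵐ ξ ∂P, y ξ ∈ b ξ := by
  classical
  have hmeas : MeasurableSet {ξ | y ξ ∈ b ξ} := by
    have h1 : Measurable fun ξ => Metric.infDist (y ξ) (b ξ) :=
      h.measurable_infDist_comp (Lp.stronglyMeasurable y).measurable measurable_id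
    convert h1 (measurableSet_singleton 0) using 1
    ext ξ
    exact (h.b_closed ξ).mem_iff_infDist_zero (h.b_nonempty ξ)
  have hind : ∀ ξ, indicatorFn (b ξ) (y ξ) = Set.indicator {ξ | y ξ ∈ b ξ}ᶜ (fun _ => ⊤) ξ := by
    intro ξ
    by_cases hξ : y ξ ∈ b ξ <;> simp [indicatorFn, hξ]
  have e : constraintG P b y = ⊤ * P {ξ | y ξ ∈ b ξ}ᶜ := by
    rw [constraintG, lintegral_congr hind, lintegral_indicator_const hmeas.compl]
  rw [domG, Set.mem_ofPred_eq, e, ae_iff]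
  change _ ↔ P {ξ | y ξ ∈ b ξ}ᶜ = 0
  constructor
  · intro hlt
    by_contra hne
    rw [ENNReal.top_mul hne] at hlt
    exact lt_irrefl _ hlt
  · intro h0
    simp [h0]

omit [IsProbabilityMeasure P] in
-- Convergence in L² gives almost sure convergence along a subsequence, and each `b ξ` is closed.
theorem Assumptions.isClosed_domG (h : Assumptions P f A b X Lf σf) : IsClosed (domG P b) := by
  refine IsSeqClosed.isClosed fun y z hy hyz => ?_
  obtain ⟨ns, -, hns⟩ := (tendstoInMeasure_of_tendsto_Lp hyz).exists_seq_tendsto_ae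
  rw [h.mem_domG_iff]
  have hy' : ∀ᵐ ξ ∂P, ∀ n, y n ξ ∈ b ξ := ae_all_iff.2 fun n => (h.mem_domG_iff _).1 (hy n)
  filter_upwards [hns, hy'] with ξ h1 h2
  exact (h.b_closed ξ).mem_of_tendsto h1 (Filter.Eventually.of_forall fun n => h2 _)

omit [IsProbabilityMeasure P] in
theorem Assumptions.convex_domG (h : Assumptions P f A b X Lf σf) : Convex ℝ (domG P b) := by
  intro y hy z hz s t hs ht hst
  rw [h.mem_domG_iff] at hy hz ⊢
  filter_upwards [hy, hz, Lp.coeFn_add (s • y) (t • z), Lp.coeFn_smul s y, Lp.coeFn_smul t z]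
    with ξ h1 h2 h3 h4 h5
  rw [h3, Pi.add_apply, h4, h5]
  exact h.b_convex ξ h1 h2 hs ht hst

/-- Closed plus compact is closed: the image of `X` is compact because a linear map on a
finite-dimensional space is continuous. Closedness is what makes the Baire argument applicable. -/
theorem Assumptions.isClosed_domG_sub (h : Assumptions P f A b X Lf σf) :
    IsClosed (domG P b - imageA P A X) := by
  rw [sub_eq_add_neg, h.imageA_eq]
  exact h.isClosed_domG.add_right_of_isCompact
    ((h.X_compact.image h.operator.continuous_of_finiteDimensional).neg)

theorem Assumptions.convex_domG_sub (h : Assumptions P f A b X Lf σf) :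
    Convex ℝ (domG P b - imageA P A X) := by
  rw [h.imageA_eq]
  exact h.convex_domG.sub (h.X_convex.linear_image _)

omit [IsProbabilityMeasure P] in
theorem Assumptions.convexOn_objective (h : Assumptions P f A b X Lf σf) :
    ConvexOn ℝ Set.univ (objective P f) := by
  refine ⟨convex_univ, fun x _ y _ s t hs ht hst => ?_⟩
  simp only [objective, smul_eq_mul]
  rw [← integral_const_mul, ← integral_const_mul, ← integral_add
    ((h.f_integrable x).const_mul s) ((h.f_integrable y).const_mul t)]
  exact integral_mono (h.f_integrable _)
    (((h.f_integrable x).const_mul s).add ((h.f_integrable y).const_mul t))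
    fun ξ => (h.f_convex ξ).2 trivial trivial hs ht hst

omit [IsProbabilityMeasure P] in
theorem Assumptions.continuous_objective (h : Assumptions P f A b X Lf σf) :
    Continuous (objective P f) := h.convexOn_objective.locallyLipschitz.continuous

/-- Weak form of strong duality: under Slater's condition the objective at a point of `X` can
fall below the optimal value by at most a multiple of the infeasibility. -/
theorem Assumptions.exists_objective_sub_le (h : Assumptions P f A b X Lf σf) {xstar : Vec d}
    (hs : IsSolution P f A b X xstar) :
    ∃ M : ℝ, 0 ≤ M ∧ ∀ x ∈ X, objective P f xstar - objective P f x
      ≤ M * √(∫ ξ, Metric.infDist (A ξ x) (b ξ) ^ 2 ∂P) := by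
  obtain ⟨r, hr, hball⟩ := exists_radius_of_zero_mem_strongRelInterior
    h.isClosed_domG_sub h.convex_domG_sub h.slater
  obtain ⟨B, hB⟩ := h.X_compact.bddAbove_image h.continuous_objective.continuousOn
  have hB' : ∀ x ∈ X, objective P f x ≤ B := fun x hx => hB ⟨x, hx, rfl⟩
  refine ⟨(B - objective P f xstar) / r,
    div_nonneg (sub_nonneg.2 (hB' _ hs.1.1)) hr.le, fun x hx => ?_⟩
  -- `y` is the pointwise projection of `A x` onto the constraint sets, and `u = y - A x` is an
  -- element of `domG - A X` whose norm is the infeasibility of `x`.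
  set y : Lp (Vec m) 2 P := h.operator x - (h.memLp_residual hs.1.2 x).toLp with hy
  set u : Lp (Vec m) 2 P := -(h.memLp_residual hs.1.2 x).toLp with hu
  have hyae : ∀ᵐ ξ ∂P, y ξ = A ξ x - residual (b ξ) (A ξ x) := by
    filter_upwards [Lp.coeFn_sub (h.operator x) (h.memLp_residual hs.1.2 x).toLp,
      h.coeFn_operator x, (h.memLp_residual hs.1.2 x).coeFn_toLp] with ξ h1 h2 h3
    rw [hy, h1, Pi.sub_apply, h2, h3]
  have hyG : y ∈ domG P b := by
    rw [h.mem_domG_iff]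
    filter_upwards [hyae] with ξ hξ
    rw [hξ]
    exact (residual_spec (h.b_nonempty ξ) (h.b_closed ξ) (h.b_convex ξ) _).1
  have huC : u ∈ domG P b - imageA P A X := by
    refine ⟨y, hyG, h.operator x, ⟨x, hx, h.coeFn_operator x⟩, ?_⟩
    simp [hy, hu]
  have hunorm : ‖u‖ = √(∫ ξ, Metric.infDist (A ξ x) (b ξ) ^ 2 ∂P) := by
    rw [hu, norm_neg, eq_comm, Real.sqrt_eq_iff_eq_sq
      (integral_nonneg fun ξ => by positivity) (norm_nonneg _), ← real_inner_self_eq_norm_sq,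
      L2.inner_def]
    refine integral_congr_ae ?_
    filter_upwards [(h.memLp_residual hs.1.2 x).coeFn_toLp] with ξ hξ
    rw [hξ, real_inner_self_eq_norm_sq, h.norm_residual_eq]
  rw [← hunorm]
  rcases eq_or_ne u 0 with hu0 | hu0
  · have : IsFeasible P A b X x := by
      refine ⟨hx, ?_⟩
      have h1 : (h.memLp_residual hs.1.2 x).toLp = 0 := by rwa [hu, neg_eq_zero] at hu0
      have h2 : h.operator x = y := by rw [hy, h1, sub_zero]
      filter_upwards [h.coeFn_operator x, (h.mem_domG_iff y).1 hyG] with ξ h3 h4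
      rwa [← h3, h2]
    have := hs.2 x this
    rw [hu0, norm_zero, mul_zero]
    linarith
  · have hn : 0 < ‖u‖ := norm_pos_iff.2 hu0
    -- The vector of norm `r` opposite to `u` is also of the form `y' - A x'`. The weights `s`, `t`
    -- below make the two perturbations cancel, so that `s • x + t • x'` is feasible; convexity of
    -- the objective then compares it with `xstar`.
    obtain ⟨y', hy', _, ⟨x', hx', hx'A⟩, hdiff⟩ := hball u huC (-(r / ‖u‖)) (by
      rw [norm_smul, norm_neg, norm_div, norm_norm, div_mul_cancel₀ _ hn.ne',
        Real.norm_of_nonneg hr.le])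
    have hx'T := Lp.ext ((hx'A).trans (h.coeFn_operator x').symm)
    subst hx'T
    set s := r / (r + ‖u‖)
    set t := ‖u‖ / (r + ‖u‖)
    have hs0 : 0 ≤ s := by positivity
    have ht0 : 0 ≤ t := by positivity
    have hst : s + t = 1 := by simp only [s, t]; field_simp
    have hcomb : h.operator (s • x + t • x') = s • y + t • y' := by
      have h1 : y = h.operator x + u := by simp [hy, hu, sub_eq_add_neg]
      have h2 : y' = h.operator x' + -(r / ‖u‖) • u := by rw [← hdiff]; exact (add_sub_cancel _ _).symm
      rw [h1, h2, map_add, map_smul, map_smul]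
      have h3 : t * (r / ‖u‖) = s := by simp only [s, t]; field_simp
      rw [smul_add, smul_add, smul_smul t, mul_neg, h3]
      module
    have hfeas : IsFeasible P A b X (s • x + t • x') := by
      refine ⟨h.X_convex hx hx' hs0 ht0 hst, ?_⟩
      have h1 : s • y + t • y' ∈ domG P b := h.convex_domG hyG hy' hs0 ht0 hst
      filter_upwards [h.coeFn_operator (s • x + t • x'), (h.mem_domG_iff _).1 h1] with ξ h3 h4
      rwa [← h3, hcomb]
    have h1 := (hs.2 _ hfeas).trans
      (h.convexOn_objective.2 (Set.mem_univ x) (Set.mem_univ x') hs0 ht0 hst)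
    simp only [smul_eq_mul] at h1
    have h2 := hB' x' hx'
    have h3 : (r + ‖u‖) * objective P f xstar ≤ r * objective P f x + ‖u‖ * B := by
      calc (r + ‖u‖) * objective P f xstar
          ≤ (r + ‖u‖) * (s * objective P f x + t * B) := by
            gcongr
            exact h1.trans (by gcongr)
        _ = _ := by simp only [s, t]; field_simp
    rw [div_mul_eq_mul_div, le_div_iff₀ hr]
    linarith

end Problem

/-! ### The smoothed objective and its stochastic gradients -/

section Gradients

variable {Ξ : Type*} [MeasurableSpace Ξ] {P : Measure Ξ} {d m : ℕ}
  {f : Vec d → Ξ → ℝ} {A : Ξ → Vec d →L[ℝ] Vec m} {b : Ξ → Set (Vec m)} {X : Set (Vec d)}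
  {Lf : ℝ≥0} {σf : ℝ}

/-- Half the gradient in `x` of `dist(A(ξ) x, b(ξ))²`. -/
def penaltyGrad (A : Ξ → Vec d →L[ℝ] Vec m) (b : Ξ → Set (Vec m)) (x : Vec d) (ξ : Ξ) : Vec d :=
  (A ξ).adjoint (residual (b ξ) (A ξ x))

/-- The gradient in `x` of `F_β(x, ξ)`. -/
def stochGrad (f : Vec d → Ξ → ℝ) (A : Ξ → Vec d →L[ℝ] Vec m) (b : Ξ → Set (Vec m)) (β : ℝ)
    (x : Vec d) (ξ : Ξ) : Vec d :=
  gradient (fun y => f y ξ) x + (1 / β) • penaltyGrad A b x ξ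

/-- The expected gradient of `F_β`. -/
def meanGrad (P : Measure Ξ) (f : Vec d → Ξ → ℝ) (A : Ξ → Vec d →L[ℝ] Vec m)
    (b : Ξ → Set (Vec m)) (β : ℝ) (x : Vec d) : Vec d :=
  ∫ ξ, stochGrad f A b β x ξ ∂P

/-- The mean squared infeasibility. -/
def infeas (P : Measure Ξ) (A : Ξ → Vec d →L[ℝ] Vec m) (b : Ξ → Set (Vec m)) (x : Vec d) : ℝ :=
  ∫ ξ, Metric.infDist (A ξ x) (b ξ) ^ 2 ∂P

/-- The expectation `F_β(x)` of the smoothed stochastic objective. -/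
def smoothedObjective (P : Measure Ξ) (f : Vec d → Ξ → ℝ) (A : Ξ → Vec d →L[ℝ] Vec m)
    (b : Ξ → Set (Vec m)) (β : ℝ) (x : Vec d) : ℝ :=
  objective P f x + 1 / (2 * β) * infeas P A b x

omit [MeasurableSpace Ξ] in
theorem inner_penaltyGrad (x v : Vec d) (ξ : Ξ) :
    inner ℝ (penaltyGrad A b x ξ) v = inner ℝ (residual (b ξ) (A ξ x)) (A ξ v) :=
  ContinuousLinearMap.adjoint_inner_left _ _ _

theorem infeas_nonneg (x : Vec d) : 0 ≤ infeas P A b x :=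
  integral_nonneg fun _ => sq_nonneg _

theorem Assumptions.sfoAnswer_snd (h : Assumptions P f A b X Lf σf) (ξ : Ξ) (β : ℝ) (x : Vec d) :
    (sfoAnswer f A b ξ β x).2 = stochGrad f A b β x ξ := by
  refine HasGradientAt.gradient ?_
  have h1 := ((h.f_differentiable ξ) x).hasGradientAt.hasFDerivAt
  have h2 := (hasGradientAt_sq_infDist (h.b_nonempty ξ) (h.b_closed ξ) (h.b_convex ξ)
    (A ξ x)).hasFDerivAt.comp x (A ξ).hasFDerivAt
  have h3 := h1.add (h2.const_mul (1 / (2 * β)))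
  rw [hasGradientAt_iff_hasFDerivAt]
  refine h3.congr_fderiv ?_
  ext v
  simp only [add_apply, smul_apply,
    ContinuousLinearMap.comp_apply, InnerProductSpace.toDual_apply_apply, stochGrad,
    inner_add_left, inner_smul_left, inner_penaltyGrad, smul_eq_mul, conj_trivial]
  ring

theorem Assumptions.measurable_penaltyGrad (h : Assumptions P f A b X Lf σf) :
    Measurable fun p : Vec d × Ξ => penaltyGrad A b p.1 p.2 := by
  refine measurable_vec fun v => ?_
  simp only [inner_penaltyGrad]
  have h1 : Measurable fun p : Vec d × Ξ => A p.2 p.1 := measurable_apply_uncurry h.A_measurable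
  exact (h.measurable_residual_comp h1 measurable_snd).inner
    ((h.measurable_apply v).comp measurable_snd)

theorem Assumptions.measurable_gradient (h : Assumptions P f A b X Lf σf) :
    Measurable fun p : Vec d × Ξ => gradient (fun y => f y p.2) p.1 :=
  measurable_uncurry_of_continuous_of_measurable
    (u := fun (x : Vec d) (ξ : Ξ) => gradient (fun y => f y ξ) x)
    (fun ξ => (h.f_smooth ξ).continuous)
    (measurable_gradient_param h.f_measurable h.f_differentiable)

theorem Assumptions.measurable_stochGrad (h : Assumptions P f A b X Lf σf) (β : ℝ) :
    Measurable fun p : Vec d × Ξ => stochGrad f A b β p.1 p.2 :=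
  h.measurable_gradient.add (h.measurable_penaltyGrad.const_smul (1 / β))

theorem Assumptions.measurable_sq_infDist (h : Assumptions P f A b X Lf σf) :
    Measurable fun p : Vec d × Ξ => Metric.infDist (A p.2 p.1) (b p.2) ^ 2 :=
  (h.measurable_infDist_comp (measurable_apply_uncurry h.A_measurable) measurable_snd).pow_const 2

variable {a D : ℝ} {xstar : Vec d}

theorem Assumptions.sq_infDist_apply_le (h : Assumptions P f A b X Lf σf) (ha : ∀ ξ, ‖A ξ‖ ≤ a)
    (x y : Vec d) (ξ : Ξ) :
    Metric.infDist (A ξ y) (b ξ) ^ 2 ≤ Metric.infDist (A ξ x) (b ξ) ^ 2 +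
      2 * inner ℝ (penaltyGrad A b x ξ) (y - x) + a ^ 2 * ‖y - x‖ ^ 2 := by
  have h1 := (sq_infDist_bounds (h.b_nonempty ξ) (h.b_closed ξ) (h.b_convex ξ)
    (A ξ x) (A ξ y)).2
  rw [inner_penaltyGrad, map_sub]
  have h2 : ‖A ξ y - A ξ x‖ ^ 2 ≤ a ^ 2 * ‖y - x‖ ^ 2 := by
    rw [← mul_pow, ← map_sub]
    gcongr
    exact (A ξ).le_of_opNorm_le (ha ξ) _
  linarith

omit [MeasurableSpace Ξ] in
theorem norm_adjoint_apply_le (ha : ∀ ξ, ‖A ξ‖ ≤ a) (ξ : Ξ) (v : Vec m) :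
    ‖(A ξ).adjoint v‖ ≤ a * ‖v‖ :=
  ContinuousLinearMap.le_of_opNorm_le _ (by simpa using ha ξ) v

theorem Assumptions.norm_penaltyGrad_sub_le (h : Assumptions P f A b X Lf σf) (h0 : 0 ≤ a)
    (ha : ∀ ξ, ‖A ξ‖ ≤ a) (x y : Vec d) (ξ : Ξ) :
    ‖penaltyGrad A b x ξ - penaltyGrad A b y ξ‖ ≤ a ^ 2 * ‖x - y‖ := by
  rw [penaltyGrad, penaltyGrad, ← map_sub]
  calc _ ≤ a * ‖residual (b ξ) (A ξ x) - residual (b ξ) (A ξ y)‖ := norm_adjoint_apply_le ha _ _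
    _ ≤ a * ‖A ξ x - A ξ y‖ := by
      gcongr
      exact norm_residual_sub_le (h.b_nonempty ξ) (h.b_closed ξ) (h.b_convex ξ) _ _
    _ ≤ a * (a * ‖x - y‖) := by
      gcongr
      rw [← map_sub]
      exact (A ξ).le_of_opNorm_le (ha ξ) _
    _ = _ := by ring

theorem Assumptions.norm_penaltyGrad_le (h : Assumptions P f A b X Lf σf) (h0 : 0 ≤ a)
    (ha : ∀ ξ, ‖A ξ‖ ≤ a) {z : Vec d} {ξ : Ξ} (hz : A ξ z ∈ b ξ) (x : Vec d) :
    ‖penaltyGrad A b x ξ‖ ≤ a ^ 2 * ‖x - z‖ := by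
  calc _ ≤ a * ‖residual (b ξ) (A ξ x)‖ := norm_adjoint_apply_le ha _ _
    _ ≤ a * (a * ‖x - z‖) := by
      gcongr
      rw [h.norm_residual_eq]
      exact infDist_apply_le ha hz x
    _ = _ := by ring

variable [IsProbabilityMeasure P]

theorem Assumptions.measurable_meanGrad (h : Assumptions P f A b X Lf σf) (β : ℝ) :
    Measurable (meanGrad P f A b β) :=
  (StronglyMeasurable.integral_prod_right (ν := P)
    (h.measurable_stochGrad β).stronglyMeasurable).measurable

theorem Assumptions.measurable_infeas (h : Assumptions P f A b X Lf σf) :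
    Measurable (infeas P A b) :=
  (StronglyMeasurable.integral_prod_right (ν := P)
    h.measurable_sq_infDist.stronglyMeasurable).measurable

theorem Assumptions.memLp_penaltyGrad (h : Assumptions P f A b X Lf σf)
    (hs : IsFeasible P A b X xstar) (x : Vec d) :
    MemLp (penaltyGrad A b x) 2 P := by
  obtain ⟨a, h0, ha⟩ := h.exists_norm_le
  refine MemLp.of_bound ?_ (a ^ 2 * ‖x - xstar‖) ?_
  · exact (h.measurable_penaltyGrad.comp measurable_prodMk_left).aestronglyMeasurable
  · filter_upwards [hs.2] with ξ hξ using h.norm_penaltyGrad_le h0 ha hξ x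

omit [IsProbabilityMeasure P] in
-- The variance assumption bounds a lower integral, so it carries square integrability as well as a
-- bound.
theorem Assumptions.memLp_gradient_sub (h : Assumptions P f A b X Lf σf)
    {x : Vec d} (hx : x ∈ X) :
    MemLp (fun ξ => gradient (fun y => f y ξ) x - gradient (objective P f) x) 2 P := by
  refine ⟨((measurable_gradient_param h.f_measurable h.f_differentiable x).sub_const
    _).aestronglyMeasurable, ?_⟩
  rw [eLpNorm_lt_top_iff_lintegral_rpow_enorm_lt_top two_ne_zero ENNReal.ofNat_ne_top]
  simpa using (h.grad_variance x hx).trans_lt ENNReal.ofReal_lt_top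

theorem Assumptions.memLp_gradient (h : Assumptions P f A b X Lf σf) {x : Vec d} (hx : x ∈ X) :
    MemLp (fun ξ => gradient (fun y => f y ξ) x) 2 P := by
  have := (h.memLp_gradient_sub hx).add (memLp_const (gradient (objective P f) x))
  simpa [Pi.add_def] using this

theorem Assumptions.memLp_stochGrad (h : Assumptions P f A b X Lf σf)
    (hs : IsFeasible P A b X xstar) {x : Vec d} (hx : x ∈ X) (β : ℝ) :
    MemLp (stochGrad f A b β x) 2 P :=
  (h.memLp_gradient hx).add ((h.memLp_penaltyGrad hs x).const_smul (1 / β))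

theorem Assumptions.integrable_stochGrad (h : Assumptions P f A b X Lf σf)
    (hs : IsFeasible P A b X xstar) {x : Vec d} (hx : x ∈ X) (β : ℝ) :
    Integrable (stochGrad f A b β x) P :=
  (h.memLp_stochGrad hs hx β).integrable (by norm_num)

theorem Assumptions.integrable_sq_infDist (h : Assumptions P f A b X Lf σf)
    (hs : IsFeasible P A b X xstar) (x : Vec d) :
    Integrable (fun ξ => Metric.infDist (A ξ x) (b ξ) ^ 2) P := by
  have := (h.memLp_residual hs.2 x).integrable_norm_pow two_ne_zero
  simpa only [h.norm_residual_eq] using this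

theorem Assumptions.infeas_le (h : Assumptions P f A b X Lf σf) (h0 : 0 ≤ a)
    (ha : ∀ ξ, ‖A ξ‖ ≤ a) (hD : ∀ x ∈ X, ∀ y ∈ X, ‖x - y‖ ≤ D) (hs : IsFeasible P A b X xstar)
    {x : Vec d} (hx : x ∈ X) : infeas P A b x ≤ (a * D) ^ 2 := by
  have : infeas P A b x ≤ ∫ _, (a * D) ^ 2 ∂P := by
    refine integral_mono_ae (h.integrable_sq_infDist hs x) (integrable_const _) ?_
    filter_upwards [hs.2] with ξ hξ
    have h1 := (infDist_apply_le ha hξ x).trans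
      (mul_le_mul_of_nonneg_left (hD x hx xstar hs.1) h0)
    have h2 := Metric.infDist_nonneg (x := A ξ x) (s := b ξ)
    gcongr
  simpa using this

theorem Assumptions.inner_meanGrad (h : Assumptions P f A b X Lf σf)
    (hs : IsFeasible P A b X xstar) {x : Vec d} (hx : x ∈ X) (β : ℝ) (v : Vec d) :
    inner ℝ (meanGrad P f A b β x) v = ∫ ξ, inner ℝ (stochGrad f A b β x ξ) v ∂P := by
  rw [real_inner_comm, meanGrad, ← integral_inner (h.integrable_stochGrad hs hx β)]
  simp only [real_inner_comm]

theorem Assumptions.integral_smoothed (h : Assumptions P f A b X Lf σf)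
    (hs : IsFeasible P A b X xstar) (β : ℝ) (x : Vec d) :
    ∫ ξ, smoothed f A b β x ξ ∂P = smoothedObjective P f A b β x := by
  simp only [smoothed]
  rw [integral_add (h.f_integrable x) ((h.integrable_sq_infDist hs x).const_mul _),
    integral_const_mul]
  rfl

theorem Assumptions.integrable_smoothed (h : Assumptions P f A b X Lf σf)
    (hs : IsFeasible P A b X xstar) (β : ℝ) (x : Vec d) :
    Integrable (smoothed f A b β x) P :=
  (h.f_integrable x).add ((h.integrable_sq_infDist hs x).const_mul _)

theorem Assumptions.smoothedObjective_le (h : Assumptions P f A b X Lf σf)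
    (ha : ∀ ξ, ‖A ξ‖ ≤ a) (hs : IsFeasible P A b X xstar) {β : ℝ} (hβ : 0 < β)
    {x : Vec d} (hx : x ∈ X) (y : Vec d) :
    smoothedObjective P f A b β y ≤ smoothedObjective P f A b β x
      + inner ℝ (meanGrad P f A b β x) (y - x) + (Lf + a ^ 2 / β) * ‖y - x‖ ^ 2 := by
  have hi := (h.integrable_stochGrad hs hx β).inner_const (𝕜 := ℝ) (y - x)
  rw [h.inner_meanGrad hs hx, ← h.integral_smoothed hs, ← h.integral_smoothed hs,
    ← integral_add (h.integrable_smoothed hs β x) hi]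
  have this : ∀ c : ℝ, c = ∫ _, c ∂P := fun c => by simp
  have hi' := (h.integrable_smoothed hs β x).fun_add hi
  rw [this ((Lf + a ^ 2 / β) * ‖y - x‖ ^ 2), ← integral_add hi' (integrable_const _)]
  refine integral_mono (h.integrable_smoothed hs β y)
    (hi'.add (integrable_const _)) fun ξ => ?_
  have h1 := le_of_lipschitz_gradient (h.f_differentiable ξ) (h.f_smooth ξ) x y
  have h2 := h.sq_infDist_apply_le ha x y ξ
  simp only [smoothed, stochGrad, inner_add_left, inner_smul_left, conj_trivial]
  have h3 := mul_le_mul_of_nonneg_left h2 (by positivity : 0 ≤ 1 / (2 * β))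
  have h4 : 1 / (2 * β) * (Metric.infDist (A ξ x) (b ξ) ^ 2 +
      2 * inner ℝ (penaltyGrad A b x ξ) (y - x) + a ^ 2 * ‖y - x‖ ^ 2) =
      1 / (2 * β) * Metric.infDist (A ξ x) (b ξ) ^ 2 +
      1 / β * inner ℝ (penaltyGrad A b x ξ) (y - x) + a ^ 2 / β * ‖y - x‖ ^ 2 / 2 := by
    field_simp
  have h5 : 0 ≤ a ^ 2 / β * ‖y - x‖ ^ 2 := by positivity
  rw [add_mul]
  linarith

/-- Convexity handles `f`; `inner_residual_le` handles the penalty and supplies the full `infeas /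
β`, twice the penalty present in the smoothed objective. -/
theorem Assumptions.inner_meanGrad_le (h : Assumptions P f A b X Lf σf)
    (hs : IsFeasible P A b X xstar) {β : ℝ} (hβ : 0 < β) {x : Vec d} (hx : x ∈ X) :
    inner ℝ (meanGrad P f A b β x) (xstar - x) ≤
      objective P f xstar - objective P f x - infeas P A b x / β := by
  have hi := (h.integrable_stochGrad hs hx β).inner_const (𝕜 := ℝ) (xstar - x)
  have hf : Integrable (fun ξ => f xstar ξ - f x ξ) P :=
    (h.f_integrable xstar).sub (h.f_integrable x)
  have hd := (h.integrable_sq_infDist hs x).div_const β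
  rw [h.inner_meanGrad hs hx, objective, objective, infeas, ← integral_sub (h.f_integrable _)
    (h.f_integrable _), ← integral_div, ← integral_sub hf hd]
  refine integral_mono_ae hi (hf.sub hd) ?_
  filter_upwards [hs.2] with ξ hξ
  have h1 := add_inner_gradient_le (h.f_convex ξ) (h.f_differentiable ξ x) xstar
  have h2 := inner_residual_le (h.b_nonempty ξ) (h.b_closed ξ) (h.b_convex ξ) (y := A ξ x) hξ
  simp only [stochGrad, inner_add_left, inner_smul_left, conj_trivial, inner_penaltyGrad, map_sub]
  have h3 := mul_le_mul_of_nonneg_left h2 (by positivity : 0 ≤ 1 / β)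
  rw [mul_neg, one_div_mul_eq_div, one_div_mul_eq_div] at h3
  rw [one_div_mul_eq_div]
  linarith

theorem Assumptions.norm_meanGrad_sub_le (h : Assumptions P f A b X Lf σf) (h0 : 0 ≤ a)
    (ha : ∀ ξ, ‖A ξ‖ ≤ a) (hs : IsFeasible P A b X xstar) {β : ℝ} (hβ : 0 < β)
    {x y : Vec d} (hx : x ∈ X) (hy : y ∈ X) :
    ‖meanGrad P f A b β x - meanGrad P f A b β y‖ ≤ (Lf + a ^ 2 / β) * ‖x - y‖ := by
  rw [meanGrad, meanGrad, ← integral_sub (h.integrable_stochGrad hs hx β)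
    (h.integrable_stochGrad hs hy β)]
  refine (norm_integral_le_of_norm_le_const (C := (Lf + a ^ 2 / β) * ‖x - y‖)
    (Filter.Eventually.of_forall fun ξ => ?_)).trans (by simp)
  rw [stochGrad, stochGrad, add_sub_add_comm, ← smul_sub]
  refine (norm_add_le _ _).trans ?_
  rw [norm_smul, Real.norm_of_nonneg (by positivity), add_mul]
  refine add_le_add (by simpa [dist_eq_norm] using (h.f_smooth ξ).dist_le_mul x y) ?_
  refine (mul_le_mul_of_nonneg_left (h.norm_penaltyGrad_sub_le h0 ha x y ξ)
    (by positivity)).trans_eq (by ring)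

theorem Assumptions.norm_integral_penaltyGrad_le (h : Assumptions P f A b X Lf σf) (h0 : 0 ≤ a)
    (ha : ∀ ξ, ‖A ξ‖ ≤ a) (hD : ∀ x ∈ X, ∀ y ∈ X, ‖x - y‖ ≤ D) (hs : IsFeasible P A b X xstar)
    {x : Vec d} (hx : x ∈ X) : ‖∫ ξ, penaltyGrad A b x ξ ∂P‖ ≤ a ^ 2 * D := by
  refine (norm_integral_le_of_norm_le_const (C := a ^ 2 * D) ?_).trans (by simp)
  filter_upwards [hs.2] with ξ hξ
  exact (h.norm_penaltyGrad_le h0 ha hξ x).trans (by gcongr; exact hD x hx _ hs.1)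

theorem Assumptions.meanGrad_eq (h : Assumptions P f A b X Lf σf)
    (hs : IsFeasible P A b X xstar) {x : Vec d} (hx : x ∈ X) (β : ℝ) :
    meanGrad P f A b β x =
      gradient (objective P f) x + (1 / β) • ∫ ξ, penaltyGrad A b x ξ ∂P := by
  rw [← h.grad_unbiased x hx, ← integral_smul, ← integral_add
    ((h.memLp_gradient hx).integrable (by norm_num))
    (((h.memLp_penaltyGrad hs x).integrable (by norm_num)).fun_smul (1 / β))]
  rfl

theorem Assumptions.norm_meanGrad_sub_meanGrad_le (h : Assumptions P f A b X Lf σf) (h0 : 0 ≤ a)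
    (ha : ∀ ξ, ‖A ξ‖ ≤ a) (hD : ∀ x ∈ X, ∀ y ∈ X, ‖x - y‖ ≤ D) (hs : IsFeasible P A b X xstar)
    {x : Vec d} (hx : x ∈ X) (β β' : ℝ) :
    ‖meanGrad P f A b β x - meanGrad P f A b β' x‖ ≤ |1 / β - 1 / β'| * (a ^ 2 * D) := by
  rw [h.meanGrad_eq hs hx, h.meanGrad_eq hs hx, add_sub_add_left_eq_sub, ← sub_smul, norm_smul,
    Real.norm_eq_abs]
  gcongr
  exact h.norm_integral_penaltyGrad_le h0 ha hD hs hx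

omit [IsProbabilityMeasure P] in
theorem Assumptions.integral_sq_norm_gradient_sub_le (h : Assumptions P f A b X Lf σf)
    {x : Vec d} (hx : x ∈ X) :
    ∫ ξ, ‖gradient (fun y => f y ξ) x - gradient (objective P f) x‖ ^ 2 ∂P ≤ σf ^ 2 := by
  have h1 := (h.memLp_gradient_sub hx).integrable_norm_pow two_ne_zero
  rw [← ENNReal.ofReal_le_ofReal_iff (by positivity), ofReal_integral_eq_lintegral_ofReal h1
    (Filter.Eventually.of_forall fun ξ => by positivity)]
  refine le_of_eq_of_le (lintegral_congr fun ξ => ?_) (h.grad_variance x hx)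
  rw [ENNReal.ofReal_pow (norm_nonneg _), ofReal_norm]

/-- The penalty gradient is almost surely at most `a² D`, because `xstar` is feasible, so its
centred version is at most `2 a² D`. The factor `8` is this square doubled by `‖u + v‖² ≤ 2‖u‖² +
2‖v‖²`. -/
theorem Assumptions.integral_sq_norm_stochGrad_sub_le (h : Assumptions P f A b X Lf σf)
    (h0 : 0 ≤ a) (ha : ∀ ξ, ‖A ξ‖ ≤ a) (hD : ∀ x ∈ X, ∀ y ∈ X, ‖x - y‖ ≤ D)
    (hs : IsFeasible P A b X xstar) {x : Vec d} (hx : x ∈ X) (β : ℝ) :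
    ∫ ξ, ‖stochGrad f A b β x ξ - meanGrad P f A b β x‖ ^ 2 ∂P ≤
      2 * σf ^ 2 + 8 * (a ^ 2 * D / β) ^ 2 := by
  have h1 := (h.memLp_gradient_sub hx).integrable_norm_pow two_ne_zero
  have h2 := ((h.memLp_stochGrad hs hx β).sub
    (memLp_const (meanGrad P f A b β x))).integrable_norm_pow two_ne_zero
  calc _ ≤ ∫ ξ, (2 * ‖gradient (fun y => f y ξ) x - gradient (objective P f) x‖ ^ 2
        + 8 * (a ^ 2 * D / β) ^ 2) ∂P := by
        refine integral_mono_ae h2 ((h1.const_mul 2).add (integrable_const _)) ?_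
        filter_upwards [hs.2] with ξ hξ
        rw [h.meanGrad_eq hs hx, stochGrad, add_sub_add_comm, ← smul_sub]
        set u := gradient (fun y => f y ξ) x - gradient (objective P f) x
        set v := penaltyGrad A b x ξ - ∫ ξ, penaltyGrad A b x ξ ∂P
        have hv : ‖v‖ ≤ 2 * (a ^ 2 * D) := by
          refine (norm_sub_le _ _).trans ?_
          have e1 := h.norm_integral_penaltyGrad_le h0 ha hD hs hx
          have e2 : ‖penaltyGrad A b x ξ‖ ≤ a ^ 2 * D :=
            (h.norm_penaltyGrad_le h0 ha hξ x).trans (by gcongr; exact hD x hx _ hs.1)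
          linarith
        have hw : ‖(1 / β) • v‖ ^ 2 ≤ 4 * (a ^ 2 * D / β) ^ 2 := by
          rw [norm_smul, mul_pow, Real.norm_eq_abs, sq_abs]
          calc (1 / β) ^ 2 * ‖v‖ ^ 2 ≤ (1 / β) ^ 2 * (2 * (a ^ 2 * D)) ^ 2 := by gcongr
            _ = _ := by ring
        have ht := norm_add_le u ((1 / β) • v)
        have hn := norm_nonneg (u + (1 / β) • v)
        nlinarith [sq_nonneg (‖u‖ - ‖(1 / β) • v‖), mul_self_le_mul_self hn ht]
    _ ≤ 2 * σf ^ 2 + 8 * (a ^ 2 * D / β) ^ 2 := by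
        rw [integral_add (h1.const_mul 2) (integrable_const _), integral_const_mul]
        have := h.integral_sq_norm_gradient_sub_le hx
        simp only [integral_const, probReal_univ, one_smul]
        linarith

/-- One update of the gradient estimator contracts its squared error, up to the variance of
the stochastic gradient. -/
theorem Assumptions.lintegral_sq_norm_estimator_le (h : Assumptions P f A b X Lf σf)
    (h0 : 0 ≤ a) (ha : ∀ ξ, ‖A ξ‖ ≤ a) (hD : ∀ x ∈ X, ∀ y ∈ X, ‖x - y‖ ≤ D)
    (hs : IsFeasible P A b X xstar) {x : Vec d} (hx : x ∈ X) (β r : ℝ) (e : Vec d) :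
    ∫⁻ ξ, ENNReal.ofReal
      (‖(1 - r) • e + r • stochGrad f A b β x ξ - meanGrad P f A b β x‖ ^ 2) ∂P ≤
    ENNReal.ofReal ((1 - r) ^ 2 * ‖e - meanGrad P f A b β x‖ ^ 2
      + r ^ 2 * (2 * σf ^ 2 + 8 * (a ^ 2 * D / β) ^ 2)) := by
  set M := meanGrad P f A b β x with hM
  have hY : MemLp (fun ξ => stochGrad f A b β x ξ - M) 2 P :=
    (h.memLp_stochGrad hs hx β).sub (memLp_const M)
  have hY2 := hY.integrable_norm_pow two_ne_zero
  have hYi : Integrable (fun ξ => stochGrad f A b β x ξ - M) P := hY.integrable (by norm_num)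
  have hYin := hYi.inner_const (𝕜 := ℝ) (e - M)
  have hexp : ∀ ξ, ‖(1 - r) • e + r • stochGrad f A b β x ξ - M‖ ^ 2 =
      (1 - r) ^ 2 * ‖e - M‖ ^ 2 +
        2 * (1 - r) * r * inner ℝ (stochGrad f A b β x ξ - M) (e - M) +
        r ^ 2 * ‖stochGrad f A b β x ξ - M‖ ^ 2 := by
    intro ξ
    have : (1 - r) • e + r • stochGrad f A b β x ξ - M =
        (1 - r) • (e - M) + r • (stochGrad f A b β x ξ - M) := by module
    rw [this, norm_add_sq_real, norm_smul, norm_smul, inner_smul_left, inner_smul_right,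
      mul_pow, mul_pow, Real.norm_eq_abs, Real.norm_eq_abs, sq_abs, sq_abs, real_inner_comm]
    simp only [conj_trivial]
    ring
  -- `M` is the mean of the stochastic gradient, so the cross term vanishes and the noise enters
  -- only with the factor `r ^ 2`.
  have hmean : ∫ ξ, inner ℝ (stochGrad f A b β x ξ - M) (e - M) ∂P = 0 := by
    simp_rw [real_inner_comm (e - M)]
    rw [integral_inner hYi, integral_sub (h.integrable_stochGrad hs hx β) (integrable_const _)]
    simp [hM, meanGrad]
  have hi1 := (integrable_const (μ := P) ((1 - r) ^ 2 * ‖e - M‖ ^ 2)).fun_add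
    (hYin.const_mul (2 * (1 - r) * r))
  have hi2 := hY2.const_mul (r ^ 2)
  simp_rw [hexp]
  rw [← ofReal_integral_eq_lintegral_ofReal (hi1.fun_add hi2)
    (Filter.Eventually.of_forall fun ξ => by rw [Pi.zero_apply]; beta_reduce; rw [← hexp]; positivity)]
  refine ENNReal.ofReal_le_ofReal ?_
  rw [integral_add hi1 hi2,
    integral_add (integrable_const _) (hYin.const_mul _), integral_const_mul, integral_const_mul,
    hmean]
  have := h.integral_sq_norm_stochGrad_sub_le h0 ha hD hs hx β
  simp only [integral_const, probReal_univ, one_smul, mul_zero, add_zero]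
  rw [integral_const_mul]
  gcongr

end Gradients

/-! ### The iterates of H-1SFW as a Markov chain -/

section Chain

variable {Ξ : Type*} {d m : ℕ}

/-- The gradient estimator `d_k`, computed from `(x_k, d_{k-1})` and the sample `ξ`. -/
def estimator (f : Vec d → Ξ → ℝ) (A : Ξ → Vec d →L[ℝ] Vec m) (b : Ξ → Set (Vec m)) (β₀ : ℝ)
    (k : ℕ) (p : Vec d × Vec d) (ξ : Ξ) : Vec d :=
  (1 - rho k) • p.2 + rho k • (sfoAnswer f A b ξ (betaSeq β₀ k) p.1).2

/-- Iteration `k` of H-1SFW, which maps `(x_k, d_{k-1})` to `(x_{k+1}, d_k)`. -/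
def step (f : Vec d → Ξ → ℝ) (A : Ξ → Vec d →L[ℝ] Vec m) (b : Ξ → Set (Vec m))
    (lmo : Vec d → Vec d) (β₀ : ℝ) (k : ℕ) (p : Vec d × Vec d) (ξ : Ξ) : Vec d × Vec d :=
  (p.1 + gam k • (lmo (estimator f A b β₀ k p ξ) - p.1), estimator f A b β₀ k p ξ)

/-- The pair `(x_{k+n}, d_{k+n-1})` reached from `p = (x_k, d_{k-1})`. -/
def chain (f : Vec d → Ξ → ℝ) (A : Ξ → Vec d →L[ℝ] Vec m) (b : Ξ → Set (Vec m))
    (lmo : Vec d → Vec d) (β₀ : ℝ) (s : ℕ → Ξ) (k : ℕ) (p : Vec d × Vec d) : ℕ → Vec d × Vec d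
  | 0 => p
  | n + 1 => step f A b lmo β₀ (k + n) (chain f A b lmo β₀ s k p n) (s (k + n))

variable {f : Vec d → Ξ → ℝ} {A : Ξ → Vec d →L[ℝ] Vec m} {b : Ξ → Set (Vec m)}
  {lmo : Vec d → Vec d} {β₀ : ℝ}

/-- The program peels off the first iteration while `chain` appends the last one; this reconciles
the two recursions. -/
theorem chain_succ' (s : ℕ → Ξ) (k : ℕ) (p : Vec d × Vec d) (n : ℕ) :
    chain f A b lmo β₀ s k p (n + 1) =
      chain f A b lmo β₀ s (k + 1) (step f A b lmo β₀ k p (s k)) n := by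
  induction n with
  | zero => rfl
  | succ n ih =>
    rw [chain, ih, chain]
    congr 1 <;> ring_nf

/-- Each iteration consumes exactly one sample, so the position in the stream stays equal to the
iteration index throughout the induction. -/
theorem run_h1sfwLoop (s : ℕ → Ξ) (n : ℕ) : ∀ (k : ℕ) (x dprev : Vec d),
    (h1sfwLoop β₀ n k x dprev).run (sfoAnswer f A b) lmo s k =
      ⟨(chain f A b lmo β₀ s k (x, dprev) n).1, n, n⟩ := by
  induction n with
  | zero => intro k x dprev; rfl
  | succ n ih =>
    intro k x dprev
    simp only [h1sfwLoop, OracleProg.run, ih, chain_succ']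
    rfl

theorem h1sfw_eq (x₁ d₀ : Vec d) (s : ℕ → Ξ) (n : ℕ) :
    h1sfw f A b lmo β₀ x₁ d₀ s n = ⟨(chain f A b lmo β₀ s 1 (x₁, d₀) n).1, n, n⟩ :=
  run_h1sfwLoop s n 1 x₁ d₀

theorem gam_mem_Icc {k : ℕ} (hk : 1 ≤ k) : gam k ∈ Set.Icc (0 : ℝ) 1 := by
  have : (1 : ℝ) ≤ k := by exact_mod_cast hk
  refine ⟨by unfold gam; positivity, ?_⟩
  rw [gam, div_le_one (by positivity)]
  linarith

theorem step_fst_mem {X : Set (Vec d)} (hX : Convex ℝ X) (hlmo : IsLMO X lmo) {k : ℕ}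
    (hk : 1 ≤ k) {p : Vec d × Vec d} (hp : p.1 ∈ X) (ξ : Ξ) :
    (step f A b lmo β₀ k p ξ).1 ∈ X :=
  hX.add_smul_sub_mem hp (hlmo _).1 (gam_mem_Icc hk)

theorem chain_fst_mem {X : Set (Vec d)} (hX : Convex ℝ X) (hlmo : IsLMO X lmo)
    {p : Vec d × Vec d} (hp : p.1 ∈ X) (s : ℕ → Ξ) (n : ℕ) :
    (chain f A b lmo β₀ s 1 p n).1 ∈ X := by
  induction n with
  | zero => exact hp
  | succ n ih => exact step_fst_mem hX hlmo (by lia) ih _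

variable [MeasurableSpace Ξ] {P : Measure Ξ} {X : Set (Vec d)} {Lf : ℝ≥0} {σf : ℝ}

theorem Assumptions.estimator_eq (h : Assumptions P f A b X Lf σf) (k : ℕ) (p : Vec d × Vec d)
    (ξ : Ξ) : estimator f A b β₀ k p ξ =
      (1 - rho k) • p.2 + rho k • stochGrad f A b (betaSeq β₀ k) p.1 ξ := by
  rw [estimator, h.sfoAnswer_snd]

theorem Assumptions.measurable_estimator (h : Assumptions P f A b X Lf σf) (k : ℕ) :
    Measurable fun q : (Vec d × Vec d) × Ξ => estimator f A b β₀ k q.1 q.2 := by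
  simp only [h.estimator_eq]
  have h1 : Measurable fun q : (Vec d × Vec d) × Ξ => (q.1.1, q.2) := by fun_prop
  have h2 := (h.measurable_stochGrad (betaSeq β₀ k)).comp h1
  have h3 : Measurable fun q : (Vec d × Vec d) × Ξ => q.1.2 := by fun_prop
  exact (h3.const_smul (1 - rho k)).add (h2.const_smul (rho k))

theorem Assumptions.measurable_step (h : Assumptions P f A b X Lf σf) (hlmo : Measurable lmo)
    (k : ℕ) : Measurable fun q : (Vec d × Vec d) × Ξ => step f A b lmo β₀ k q.1 q.2 := by
  have h1 := h.measurable_estimator (β₀ := β₀) k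
  have h2 : Measurable fun q : (Vec d × Vec d) × Ξ => q.1.1 := by fun_prop
  exact (h2.add (((hlmo.comp h1).sub h2).const_smul (gam k))).prodMk h1

variable {Ω : Type*} [MeasurableSpace Ω] {μ : Measure Ω} {ξ : ℕ → Ω → Ξ}

omit [MeasurableSpace Ω] in
-- The state after `n` iterations depends only on samples of index at most `n`, hence is independent
-- of the sample of index `n + 1`.
theorem Assumptions.measurable_chain_iSup (h : Assumptions P f A b X Lf σf)
    (hlmo : Measurable lmo) (p : Vec d × Vec d) (n : ℕ) :
    Measurable[⨆ i ∈ {i | i ≤ n}, MeasurableSpace.comap (ξ i) inferInstance]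
      fun ω => chain f A b lmo β₀ (fun i => ξ i ω) 1 p n := by
  induction n with
  | zero => exact measurable_const
  | succ n ih =>
    refine (h.measurable_step (β₀ := β₀) hlmo (1 + n)).comp (Measurable.prodMk ?_ ?_)
    · exact ih.mono (biSup_mono fun i (hi : i ≤ n) => Nat.le_succ_of_le hi) le_rfl
    · refine Measurable.mono (comap_measurable (ξ (1 + n))) ?_ le_rfl
      exact le_biSup (fun i => MeasurableSpace.comap (ξ i) inferInstance)
        (show 1 + n ∈ {i | i ≤ n + 1} by simp [add_comm])

theorem Assumptions.measurable_chain (h : Assumptions P f A b X Lf σf)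
    (hlmo : Measurable lmo) (hξ : ∀ k, Measurable (ξ k)) (p : Vec d × Vec d) (n : ℕ) :
    Measurable fun ω => chain f A b lmo β₀ (fun i => ξ i ω) 1 p n :=
  (h.measurable_chain_iSup hlmo p n).mono (iSup₂_le fun i _ => (hξ i).comap_le) le_rfl

theorem Assumptions.indepFun_chain (h : Assumptions P f A b X Lf σf)
    (hlmo : Measurable lmo) (hξ : ∀ k, Measurable (ξ k)) (hind : iIndepFun ξ μ)
    (p : Vec d × Vec d) (n : ℕ) :
    IndepFun (fun ω => chain f A b lmo β₀ (fun i => ξ i ω) 1 p n) (ξ (n + 1)) μ := by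
  have h1 := indep_iSup_of_disjoint (fun i => (hξ i).comap_le) hind.iIndep
    (S := {i | i ≤ n}) (T := {n + 1}) (by simp)
  rw [IndepFun_iff_Indep]
  refine indep_of_indep_of_le_left (indep_of_indep_of_le_right h1 ?_)
    (h.measurable_chain_iSup hlmo p n).comap_le
  simp

/-- Integrals over a state of the chain and the next sample factor. -/
theorem Assumptions.lintegral_chain (h : Assumptions P f A b X Lf σf) [IsProbabilityMeasure P]
    [IsProbabilityMeasure μ]
    (hlmo : Measurable lmo) (hξ : ∀ k, Measurable (ξ k)) (hmap : ∀ k, μ.map (ξ k) = P)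
    (hind : iIndepFun ξ μ) (p : Vec d × Vec d) (n : ℕ) {φ : (Vec d × Vec d) × Ξ → ℝ≥0∞}
    (hφ : Measurable φ) :
    ∫⁻ ω, φ (chain f A b lmo β₀ (fun i => ξ i ω) 1 p n, ξ (n + 1) ω) ∂μ =
      ∫⁻ ω, ∫⁻ ζ, φ (chain f A b lmo β₀ (fun i => ξ i ω) 1 p n, ζ) ∂P ∂μ := by
  have hm := h.measurable_chain (β₀ := β₀) hlmo hξ p n
  have h1 := (indepFun_iff_map_prod_eq_prod_map_map hm.aemeasurable (hξ (n + 1)).aemeasurable).1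
    (h.indepFun_chain hlmo hξ hind p n)
  rw [hmap] at h1
  rw [← lintegral_map hφ (hm.prodMk (hξ (n + 1))), h1, lintegral_prod _ hφ.aemeasurable,
    lintegral_map hφ.lintegral_prod_right' hm]

end Chain

/-! ### Step sizes and scalar recursions -/

section Numerics

/-- The sixth root. -/
def sixth (t : ℝ) : ℝ := t ^ (1 / 6 : ℝ)

theorem sixth_pos {t : ℝ} (ht : 0 < t) : 0 < sixth t := Real.rpow_pos_of_pos ht _

theorem sixth_pow {t : ℝ} (ht : 0 ≤ t) : sixth t ^ 6 = t := by
  rw [sixth, ← Real.rpow_natCast, ← Real.rpow_mul ht]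
  norm_num

theorem sixth_mono {s t : ℝ} (hs : 0 ≤ s) (hst : s ≤ t) : sixth s ≤ sixth t :=
  Real.rpow_le_rpow hs hst (by norm_num)

theorem one_le_sixth {t : ℝ} (ht : 1 ≤ t) : 1 ≤ sixth t :=
  Real.one_le_rpow ht (by norm_num)

theorem sixth_one : sixth 1 = 1 := Real.one_rpow _

/-- That is, `sixth t / t` is nonincreasing. This controls the ratios and increments of consecutive
sixth roots without derivatives. -/
theorem sixth_mul_le {s t : ℝ} (hs : 0 < s) (hst : s ≤ t) : sixth t * s ≤ sixth s * t := by
  have h1 := sixth_pos hs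
  have h2 := sixth_mono hs.le hst
  calc sixth t * s = sixth t * sixth s * sixth s ^ 5 := by
        conv_lhs => rw [← sixth_pow hs.le]
        ring
    _ ≤ sixth t * sixth s * sixth t ^ 5 := by have := h1.trans_le h2; gcongr
    _ = sixth s * sixth t ^ 6 := by ring
    _ = sixth s * t := by rw [sixth_pow (hs.le.trans hst)]

theorem rpow_neg_sixth {t : ℝ} (ht : 0 ≤ t) : t ^ (-(1 / 6) : ℝ) = (sixth t)⁻¹ :=
  Real.rpow_neg ht _

theorem rho_eq (k : ℕ) : rho k = 3 / sixth (k + 5) ^ 4 := by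
  rw [rho, sixth, ← Real.rpow_natCast (_ ^ _), ← Real.rpow_mul (by positivity)]
  norm_num

theorem betaSeq_eq (β₀ : ℝ) (k : ℕ) : betaSeq β₀ k = β₀ / sixth (k + 1) := rfl

theorem betaSeq_pos {β₀ : ℝ} (h : 0 < β₀) (k : ℕ) : 0 < betaSeq β₀ k :=
  div_pos h (sixth_pos (by positivity))

theorem one_div_betaSeq (β₀ : ℝ) (k : ℕ) : 1 / betaSeq β₀ k = sixth (k + 1) / β₀ := by
  rw [betaSeq_eq, one_div_div]

theorem rho_pos (k : ℕ) : 0 < rho k := by unfold rho; positivity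

theorem rho_le_one {k : ℕ} (hk : 1 ≤ k) : rho k ≤ 1 := by
  have hk' : (1 : ℝ) ≤ k := by exact_mod_cast hk
  have h0 : 0 < sixth (k + 5 : ℝ) := sixth_pos (by positivity)
  rw [rho_eq, div_le_one (by positivity)]
  have h1 : (sixth (k + 5 : ℝ) ^ 4) ^ 3 = ((k : ℝ) + 5) ^ 2 := by
    rw [← sixth_pow (by positivity : (0 : ℝ) ≤ k + 5), ← pow_mul, ← pow_mul,
      sixth_pow (by positivity : (0 : ℝ) ≤ k + 5)]
  -- After cubing, the claim is `27 ≤ (k + 5)²`, which holds from `k = 1` but fails at `k = 0`.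
  refine le_of_pow_le_pow_left₀ three_ne_zero (by positivity) ?_
  rw [h1]
  nlinarith

theorem gam_le (k : ℕ) (hk : 1 ≤ k) : gam k ≤ 6 / sixth (k + 5) ^ 6 := by
  have hk' : (1 : ℝ) ≤ k := by exact_mod_cast hk
  rw [gam, sixth_pow (by positivity), div_le_div_iff₀ (by positivity) (by positivity)]
  linarith

theorem abs_one_div_betaSeq_sub_le {β₀ : ℝ} (h : 0 < β₀) {k : ℕ} (hk : 1 ≤ k) :
    |1 / betaSeq β₀ (k + 1) - 1 / betaSeq β₀ k| ≤ 3 / β₀ / sixth (k + 5) ^ 5 := by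
  have hk' : (1 : ℝ) ≤ k := by exact_mod_cast hk
  have e1 : (0 : ℝ) < k + 1 := by positivity
  have e2 : (0 : ℝ) ≤ k + 5 := by positivity
  rw [one_div_betaSeq, one_div_betaSeq, ← sub_div]
  push_cast
  have h1 : sixth (k + 1) ≤ sixth (k + 1 + 1) := sixth_mono (by positivity) (by linarith)
  have h2 := sixth_mul_le e1 (by linarith : (k : ℝ) + 1 ≤ k + 1 + 1)
  have h3 : sixth (k + 1) ≤ sixth (k + 5) := sixth_mono (by positivity) (by linarith)
  have h5 : 0 < sixth ((k : ℝ) + 5) := sixth_pos (by positivity)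
  rw [abs_of_nonneg (div_nonneg (sub_nonneg.2 h1) h.le), div_right_comm]
  refine div_le_div_of_nonneg_right ?_ h.le
  rw [le_div_iff₀ (by positivity)]
  refine le_of_mul_le_mul_right ?_ (mul_pos h5 e1)
  calc (sixth (k + 1 + 1) - sixth (k + 1)) * sixth (k + 5) ^ 5 * (sixth (k + 5) * (k + 1))
      = ((sixth (k + 1 + 1) - sixth (k + 1)) * (k + 1)) * sixth (k + 5) ^ 6 := by ring
    _ = ((sixth (k + 1 + 1) - sixth (k + 1)) * (k + 1)) * (k + 5) := by rw [sixth_pow e2]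
    _ ≤ sixth (k + 5) * (k + 5) := by gcongr; linarith
    _ ≤ sixth (k + 5) * (3 * (k + 1)) := by gcongr; linarith
    _ = 3 * (sixth (k + 5) * (k + 1)) := by ring

/-- One step of the recursion for the mean squared error of the gradient estimator. -/
theorem estimator_recursion {Q c : ℝ} (hc : c ≤ Q) (h0 : 0 ≤ Q) {k : ℕ} (hk : 1 ≤ k) :
    (1 - rho k) * (Q / sixth (k + 4) ^ 2) + c / sixth (k + 5) ^ 6 ≤ Q / sixth (k + 5) ^ 2 := by
  have hk' : (1 : ℝ) ≤ k := by exact_mod_cast hk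
  have hσ : 0 < sixth ((k : ℝ) + 4) := sixth_pos (by positivity)
  have hτ1 : 1 ≤ sixth ((k : ℝ) + 5) := one_le_sixth (by linarith)
  have h1 : sixth ((k : ℝ) + 4) ≤ sixth (k + 5) := sixth_mono (by positivity) (by linarith)
  have h2 : sixth ((k : ℝ) + 4) ^ 6 = sixth (k + 5) ^ 6 - 1 := by
    rw [sixth_pow (by positivity), sixth_pow (by positivity)]; ring
  have hρ := rho_le_one hk
  rw [rho_eq] at hρ ⊢
  have h6 : 2 ≤ sixth ((k : ℝ) + 5) ^ 6 := by rw [sixth_pow (by positivity)]; linarith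
  set σ := sixth ((k : ℝ) + 4)
  set τ := sixth ((k : ℝ) + 5)
  have hτ : 0 < τ := by positivity
  -- Since `σ ≤ τ`, `(τ/σ)²` is at most `(τ/σ)⁶ = τ⁶/(τ⁶ - 1)`, which is at most `1 + 2/τ⁶`.
  have h3 : 1 / σ ^ 2 ≤ 1 / τ ^ 2 * (1 + 2 / τ ^ 6) := by
    have e1 : τ ^ 2 * σ ^ 6 ≤ σ ^ 2 * τ ^ 6 := by
      calc τ ^ 2 * σ ^ 6 = τ ^ 2 * σ ^ 2 * σ ^ 4 := by ring
        _ ≤ τ ^ 2 * σ ^ 2 * τ ^ 4 := by gcongr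
        _ = _ := by ring
    have e2 : τ ^ 6 ≤ (1 + 2 / τ ^ 6) * σ ^ 6 := by
      rw [h2]
      have : (1 + 2 / τ ^ 6) * (τ ^ 6 - 1) = τ ^ 6 + 1 - 2 / τ ^ 6 := by field_simp; ring
      rw [this]
      have : 2 / τ ^ 6 ≤ 1 := by rw [div_le_one (by positivity)]; exact h6
      linarith
    rw [one_div_mul_eq_div, div_le_div_iff₀ (by positivity) (by positivity), one_mul]
    refine le_of_mul_le_mul_right ?_ (by positivity : 0 < σ ^ 6)
    calc τ ^ 2 * σ ^ 6 ≤ σ ^ 2 * τ ^ 6 := e1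
      _ ≤ σ ^ 2 * ((1 + 2 / τ ^ 6) * σ ^ 6) := by gcongr
      _ = _ := by ring
  -- This is where the `3` in `rho` is spent: two units absorb the index shift, and the third pays
  -- for the noise term `Q / τ ^ 6`.
  have h4 : (1 - 3 / τ ^ 4) * (1 + 2 / τ ^ 6) ≤ 1 - 1 / τ ^ 4 := by
    have e1 : 1 / τ ^ 6 ≤ 1 / τ ^ 4 := one_div_le_one_div_of_le (by positivity)
      (pow_le_pow_right₀ hτ1 (by norm_num))
    have e2 : 0 ≤ 3 / τ ^ 4 * (2 / τ ^ 6) := by positivity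
    have e3 : 3 / τ ^ 4 = 3 * (1 / τ ^ 4) := by ring
    have e4 : 2 / τ ^ 6 = 2 * (1 / τ ^ 6) := by ring
    nlinarith
  calc (1 - 3 / τ ^ 4) * (Q / σ ^ 2) + c / τ ^ 6
      = Q * ((1 - 3 / τ ^ 4) * (1 / σ ^ 2)) + c / τ ^ 6 := by ring
    _ ≤ Q * ((1 - 3 / τ ^ 4) * (1 / τ ^ 2 * (1 + 2 / τ ^ 6))) + Q / τ ^ 6 := by
        gcongr
    _ = Q / τ ^ 2 * ((1 - 3 / τ ^ 4) * (1 + 2 / τ ^ 6)) + Q / τ ^ 6 := by ring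
    _ ≤ Q / τ ^ 2 * (1 - 1 / τ ^ 4) + Q / τ ^ 6 := by gcongr
    _ = Q / τ ^ 2 := by field_simp; ring

/-- One step of the recursion for the gap of the smoothed objective. -/
theorem gap_recursion {K G : ℝ} (hG : 2 * G ≤ K) (h0 : 0 ≤ K) {k : ℕ} (hk : 1 ≤ k) :
    (1 - gam k) * (K / sixth k) + gam k * (G / sixth k) ≤ K / sixth (k + 1) := by
  have hk' : (1 : ℝ) ≤ k := by exact_mod_cast hk
  have h1 := sixth_mul_le (by linarith : (0 : ℝ) < k) (by linarith : (k : ℝ) ≤ k + 1)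
  have h2 : 0 < sixth (k : ℝ) := sixth_pos (by linarith)
  have h3 : 0 < sixth ((k : ℝ) + 1) := sixth_pos (by linarith)
  -- Because `G ≤ K/2`, the averaged numerator is at most `(1 - γ/2) K`, and `1 - γ/2 = k/(k + 1)`.
  have h4 : K * (k / (k + 1)) / sixth k ≤ K / sixth (k + 1) := by
    rw [div_le_div_iff₀ h2 h3, mul_assoc]
    gcongr
    rw [div_mul_eq_mul_div, div_le_iff₀ (by positivity)]
    linarith
  refine le_trans ?_ h4
  rw [← mul_div_assoc, ← mul_div_assoc, ← add_div]
  gcongr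
  rw [gam, ← mul_div_assoc, le_div_iff₀ (by positivity)]
  field_simp
  nlinarith

/-- The decrease of the penalty parameter is slow enough for the Frank–Wolfe step to absorb. -/
theorem one_sub_two_gam_mul_le {β₀ : ℝ} (h : 0 < β₀) {k : ℕ} (hk : 1 ≤ k) :
    (1 - 2 * gam k) * (1 / betaSeq β₀ k) ≤ (1 - gam k) * (sixth k / β₀) := by
  have hk' : (1 : ℝ) ≤ k := by exact_mod_cast hk
  have h1 := sixth_mul_le (by linarith : (0 : ℝ) < k) (by linarith : (k : ℝ) ≤ k + 1)
  have h2 : 0 < sixth (k : ℝ) := sixth_pos (by linarith)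
  have h3 : 0 < sixth ((k : ℝ) + 1) := sixth_pos (by linarith)
  rw [one_div_betaSeq, ← mul_div_assoc, ← mul_div_assoc]
  refine div_le_div_of_nonneg_right ?_ h.le
  have e1 : 1 - 2 * gam k = (k - 3) / (k + 1) := by rw [gam]; field_simp; ring
  have e2 : 1 - gam k = (k - 1) / (k + 1) := by rw [gam]; field_simp; ring
  rw [e1, e2, div_mul_eq_mul_div, div_mul_eq_mul_div]
  refine div_le_div_of_nonneg_right ?_ (by positivity)
  -- The factor `sixth k / β₀` on the right is `1/β_{k-1}`. For `k ≤ 3` the left side is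
  -- nonpositive.
  rcases le_total (k : ℝ) 3 with h3k | h3k
  · exact (mul_nonpos_of_nonpos_of_nonneg (by linarith) h3.le).trans
      (mul_nonneg (by linarith) h2.le)
  · refine le_of_mul_le_mul_right ?_ (by linarith : (0 : ℝ) < k)
    calc ((k : ℝ) - 3) * sixth (k + 1) * k = (k - 3) * (sixth (k + 1) * k) := by ring
      _ ≤ (k - 3) * (sixth k * (k + 1)) := by
        refine mul_le_mul_of_nonneg_left h1 (by linarith)
      _ = sixth k * ((k - 3) * (k + 1)) := by ring
      _ ≤ sixth k * ((k - 1) * k) := by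
        refine mul_le_mul_of_nonneg_left ?_ h2.le
        nlinarith
      _ = _ := by ring

end Numerics

/-- A bound on the second moment bounds the first moment. -/
theorem integral_le_of_lintegral_sq_le {Ω : Type*} [MeasurableSpace Ω] {μ : Measure Ω}
    [IsProbabilityMeasure μ] {g : Ω → ℝ} (hg : Measurable g) (h0 : ∀ ω, 0 ≤ g ω) {Δ κ : ℝ}
    (hΔ : 0 ≤ Δ) (hκ : 0 < κ) (h : ∫⁻ ω, ENNReal.ofReal (g ω ^ 2) ∂μ ≤ ENNReal.ofReal Δ) :
    Integrable g μ ∧ ∫ ω, g ω ∂μ ≤ κ * Δ + 1 / κ := by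
  have h2 : Integrable (fun ω => g ω ^ 2) μ := by
    refine ⟨(hg.pow_const 2).aestronglyMeasurable, ?_⟩
    rw [hasFiniteIntegral_iff_ofReal (Filter.Eventually.of_forall fun ω => sq_nonneg _)]
    exact h.trans_lt ENNReal.ofReal_lt_top
  have h3 : ∫ ω, g ω ^ 2 ∂μ ≤ Δ := by
    rw [← ENNReal.ofReal_le_ofReal_iff hΔ, ofReal_integral_eq_lintegral_ofReal h2
      (Filter.Eventually.of_forall fun ω => sq_nonneg _)]
    exact h
  have hb : ∀ ω, g ω ≤ κ * g ω ^ 2 + 1 / κ := by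
    intro ω
    have h4 : 0 ≤ κ * (g ω - 1 / κ) ^ 2 := by positivity
    have h5 : κ * (g ω - 1 / κ) ^ 2 = κ * g ω ^ 2 - 2 * g ω + 1 / κ := by
      field_simp
      ring
    linarith [h0 ω]
  have hint : Integrable (fun ω => κ * g ω ^ 2 + 1 / κ) μ :=
    (h2.const_mul κ).add (integrable_const _)
  have hi : Integrable g μ := hint.mono' hg.aestronglyMeasurable
    (Filter.Eventually.of_forall fun ω => by rw [Real.norm_of_nonneg (h0 ω)]; exact hb ω)
  refine ⟨hi, (integral_mono hi hint hb).trans ?_⟩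
  rw [integral_add (h2.const_mul κ) (integrable_const _), integral_const_mul]
  simp only [integral_const, probReal_univ, one_smul]
  gcongr

/-! ### Convergence of H-1SFW -/

section Convergence

variable {Ξ : Type*} [MeasurableSpace Ξ] {P : Measure Ξ} {d m : ℕ}
  {f : Vec d → Ξ → ℝ} {A : Ξ → Vec d →L[ℝ] Vec m} {b : Ξ → Set (Vec m)} {X : Set (Vec d)}
  {Lf : ℝ≥0} {σf : ℝ} {lmo : Vec d → Vec d} {β₀ : ℝ} {a D : ℝ} {xstar : Vec d}
  [IsProbabilityMeasure P]

omit [MeasurableSpace Ξ] in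
theorem norm_step_sub_le (hD : ∀ x ∈ X, ∀ y ∈ X, ‖x - y‖ ≤ D) (hlmo : IsLMO X lmo) {k : ℕ}
    (hk : 1 ≤ k) {p : Vec d × Vec d} (hp : p.1 ∈ X) (ζ : Ξ) :
    ‖(step f A b lmo β₀ k p ζ).1 - p.1‖ ≤ gam k * D := by
  have h1 := (gam_mem_Icc hk).1
  rw [step, add_sub_cancel_left, norm_smul, Real.norm_of_nonneg h1]
  gcongr
  exact hD _ (hlmo _).1 _ hp

theorem one_div_betaSeq_le (hβ : 0 < β₀) (k : ℕ) :
    1 / betaSeq β₀ k ≤ sixth (k + 5) / β₀ := by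
  rw [one_div_betaSeq]
  gcongr
  exact sixth_mono (by positivity) (by linarith)

/-- The expected gradients at consecutive iterations are close. -/
theorem Assumptions.norm_meanGrad_step_sub_le (h : Assumptions P f A b X Lf σf) (h0 : 0 ≤ a)
    (ha : ∀ ξ, ‖A ξ‖ ≤ a) (hD0 : 0 ≤ D) (hD : ∀ x ∈ X, ∀ y ∈ X, ‖x - y‖ ≤ D)
    (hs : IsFeasible P A b X xstar) (hβ : 0 < β₀) (hlmo : IsLMO X lmo) {k : ℕ}
    (hk : 1 ≤ k) {p : Vec d × Vec d} (hp : p.1 ∈ X) (ζ : Ξ) :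
    ‖meanGrad P f A b (betaSeq β₀ k) p.1 -
        meanGrad P f A b (betaSeq β₀ (k + 1)) (step f A b lmo β₀ k p ζ).1‖ ≤
      (6 * (Lf + a ^ 2 / β₀) * D + 3 * a ^ 2 * D / β₀) / sixth (k + 5) ^ 5 := by
  have hx' := step_fst_mem (f := f) (A := A) (b := b) (β₀ := β₀) h.X_convex hlmo hk hp ζ
  set x' := (step f A b lmo β₀ k p ζ).1
  have hτ1 : 1 ≤ sixth ((k : ℝ) + 5) := one_le_sixth (by linarith [k.cast_nonneg (α := ℝ)])
  have h1 : ‖meanGrad P f A b (betaSeq β₀ k) p.1 - meanGrad P f A b (betaSeq β₀ k) x'‖ ≤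
      6 * (Lf + a ^ 2 / β₀) * D / sixth (k + 5) ^ 5 := by
    refine (h.norm_meanGrad_sub_le h0 ha hs (betaSeq_pos hβ k) hp hx').trans ?_
    have e1 : (Lf : ℝ) + a ^ 2 / betaSeq β₀ k ≤ (Lf + a ^ 2 / β₀) * sixth (k + 5) := by
      rw [add_mul]
      refine add_le_add (le_mul_of_one_le_right Lf.2 hτ1) ?_
      calc a ^ 2 / betaSeq β₀ k = a ^ 2 * (1 / betaSeq β₀ k) := by ring
        _ ≤ a ^ 2 * (sixth (k + 5) / β₀) :=
          mul_le_mul_of_nonneg_left (one_div_betaSeq_le hβ k) (sq_nonneg a)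
        _ = _ := by ring
    have e2 : ‖p.1 - x'‖ ≤ 6 / sixth (k + 5) ^ 6 * D := by
      rw [norm_sub_rev]
      exact (norm_step_sub_le hD hlmo hk hp ζ).trans (by gcongr; exact gam_le k hk)
    calc _ ≤ (Lf + a ^ 2 / β₀) * sixth (k + 5) * (6 / sixth (k + 5) ^ 6 * D) := by gcongr
      _ = _ := by field_simp
  have h2 : ‖meanGrad P f A b (betaSeq β₀ k) x' - meanGrad P f A b (betaSeq β₀ (k + 1)) x'‖ ≤
      3 * a ^ 2 * D / β₀ / sixth (k + 5) ^ 5 := by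
    refine (h.norm_meanGrad_sub_meanGrad_le h0 ha hD hs hx' _ _).trans ?_
    rw [abs_sub_comm]
    calc _ ≤ 3 / β₀ / sixth (k + 5) ^ 5 * (a ^ 2 * D) := by
          gcongr; exact abs_one_div_betaSeq_sub_le hβ hk
      _ = _ := by ring
  rw [add_div]
  exact (norm_sub_le_norm_sub_add_norm_sub _ _ _).trans (add_le_add h1 h2)

/-- The variance term of the estimator recursion. -/
theorem sq_rho_mul_variance_le (hβ : 0 < β₀) (k : ℕ) :
    rho k ^ 2 * (2 * σf ^ 2 + 8 * (a ^ 2 * D / betaSeq β₀ k) ^ 2) ≤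
      9 * (2 * σf ^ 2 + 8 * (a ^ 2 * D / β₀) ^ 2) / sixth (k + 5) ^ 6 := by
  have hτ1 : 1 ≤ sixth ((k : ℝ) + 5) := one_le_sixth (by linarith [k.cast_nonneg (α := ℝ)])
  have hβk := betaSeq_pos hβ k
  have e1 : (a ^ 2 * D / betaSeq β₀ k) ^ 2 ≤ (a ^ 2 * D / β₀) ^ 2 * sixth (k + 5) ^ 2 := by
    calc _ = (a ^ 2 * D) ^ 2 * (1 / betaSeq β₀ k) ^ 2 := by ring
      _ ≤ (a ^ 2 * D) ^ 2 * (sixth (k + 5) / β₀) ^ 2 :=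
        mul_le_mul_of_nonneg_left (pow_le_pow_left₀ (one_div_pos.2 hβk).le
          (one_div_betaSeq_le hβ k) 2) (sq_nonneg _)
      _ = _ := by ring
  have e2 : σf ^ 2 ≤ σf ^ 2 * sixth (k + 5) ^ 2 :=
    le_mul_of_one_le_right (sq_nonneg _) (one_le_pow₀ hτ1)
  rw [rho_eq]
  calc _ ≤ (3 / sixth (k + 5) ^ 4) ^ 2 *
        (2 * (σf ^ 2 * sixth (k + 5) ^ 2) + 8 * ((a ^ 2 * D / β₀) ^ 2 * sixth (k + 5) ^ 2)) := by
        gcongr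
    _ = _ := by field_simp; ring

theorem sq_norm_add_le_of_pos {E : Type*} [NormedAddCommGroup E] {r : ℝ} (hr : 0 < r) (u v : E) :
    ‖u + v‖ ^ 2 ≤ (1 + r) * ‖u‖ ^ 2 + (1 + 1 / r) * ‖v‖ ^ 2 := by
  have h1 : ‖u + v‖ ^ 2 ≤ (‖u‖ + ‖v‖) ^ 2 := by gcongr; exact norm_add_le u v
  have h2 : (1 + r) * ‖u‖ ^ 2 + (1 + 1 / r) * ‖v‖ ^ 2 - (‖u‖ + ‖v‖) ^ 2 =
      (r * ‖u‖ - ‖v‖) ^ 2 / r := by field_simp; ring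
  have h3 : 0 ≤ (r * ‖u‖ - ‖v‖) ^ 2 / r := by positivity
  linarith

variable {Ω : Type*} [MeasurableSpace Ω] {μ : Measure Ω} [IsProbabilityMeasure μ]
  {ξ : ℕ → Ω → Ξ}

omit [MeasurableSpace Ξ] in
theorem chain_succ (s : ℕ → Ξ) (p : Vec d × Vec d) (n : ℕ) :
    chain f A b lmo β₀ s 1 p (n + 1) =
      step f A b lmo β₀ (n + 1) (chain f A b lmo β₀ s 1 p n) (s (n + 1)) := by
  rw [chain, add_comm 1 n]

/-- The mean squared error of the estimator after the update at iteration `n + 1`, in terms of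
the error before it. -/
theorem Assumptions.lintegral_estimator_le (h : Assumptions P f A b X Lf σf) (h0 : 0 ≤ a)
    (ha : ∀ ξ, ‖A ξ‖ ≤ a) (hD : ∀ x ∈ X, ∀ y ∈ X, ‖x - y‖ ≤ D)
    (hs : IsFeasible P A b X xstar) (hβ : 0 < β₀) (hlmo : IsLMO X lmo) (hlm : Measurable lmo)
    (hξ : ∀ k, Measurable (ξ k)) (hmap : ∀ k, μ.map (ξ k) = P) (hind : iIndepFun ξ μ)
    {p : Vec d × Vec d} (hp : p.1 ∈ X) (n : ℕ) {e : ℝ}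
    (he : ∫⁻ ω, ENNReal.ofReal (‖(chain f A b lmo β₀ (fun i => ξ i ω) 1 p n).2 -
      meanGrad P f A b (betaSeq β₀ (n + 1))
        (chain f A b lmo β₀ (fun i => ξ i ω) 1 p n).1‖ ^ 2) ∂μ ≤ ENNReal.ofReal e)
    (he0 : 0 ≤ e) :
    ∫⁻ ω, ENNReal.ofReal (‖(chain f A b lmo β₀ (fun i => ξ i ω) 1 p (n + 1)).2 -
      meanGrad P f A b (betaSeq β₀ (n + 1))
        (chain f A b lmo β₀ (fun i => ξ i ω) 1 p n).1‖ ^ 2) ∂μ ≤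
    ENNReal.ofReal ((1 - rho (n + 1)) ^ 2 * e +
      9 * (2 * σf ^ 2 + 8 * (a ^ 2 * D / β₀) ^ 2) / sixth ((n + 1 : ℕ) + 5) ^ 6) := by
  simp only [chain_succ, step]
  set k := n + 1 with hk
  have hM : Measurable fun q : (Vec d × Vec d) × Ξ =>
      meanGrad P f A b (betaSeq β₀ k) q.1.1 :=
    (h.measurable_meanGrad _).comp (by fun_prop)
  have hφ : Measurable fun q : (Vec d × Vec d) × Ξ => ENNReal.ofReal
      (‖estimator f A b β₀ k q.1 q.2 - meanGrad P f A b (betaSeq β₀ k) q.1.1‖ ^ 2) :=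
    (((h.measurable_estimator k).sub hM).norm.pow_const 2).ennreal_ofReal
  -- Independence lets the new sample be integrated first, with the state frozen.
  have h1 := h.lintegral_chain (β₀ := β₀) hlm hξ hmap hind p n hφ
  refine h1.trans_le ?_
  set c := 9 * (2 * σf ^ 2 + 8 * (a ^ 2 * D / β₀) ^ 2) / sixth (k + 5) ^ 6 with hc
  have hc0 : 0 ≤ c := by
    have := sixth_pos (by positivity : (0 : ℝ) < k + 5)
    positivity
  calc _ ≤ ∫⁻ ω, (ENNReal.ofReal ((1 - rho k) ^ 2) *
        ENNReal.ofReal (‖(chain f A b lmo β₀ (fun i => ξ i ω) 1 p n).2 -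
          meanGrad P f A b (betaSeq β₀ k) (chain f A b lmo β₀ (fun i => ξ i ω) 1 p n).1‖ ^ 2)
        + ENNReal.ofReal c) ∂μ := by
        refine lintegral_mono fun ω => ?_
        have hmem := chain_fst_mem (f := f) (A := A) (b := b) (β₀ := β₀) h.X_convex hlmo hp
          (fun i => ξ i ω) n
        have h2 := h.lintegral_sq_norm_estimator_le h0 ha hD hs hmem (betaSeq β₀ k) (rho k)
          (chain f A b lmo β₀ (fun i => ξ i ω) 1 p n).2
        simp only [h.estimator_eq]
        refine h2.trans ?_
        rw [← ENNReal.ofReal_mul (by positivity), ← ENNReal.ofReal_add (by positivity) hc0]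
        exact ENNReal.ofReal_le_ofReal (add_le_add le_rfl (sq_rho_mul_variance_le hβ k))
    _ ≤ _ := by
        rw [lintegral_add_right _ measurable_const, lintegral_const_mul' _ _ ENNReal.ofReal_ne_top,
          lintegral_const, measure_univ, mul_one, ENNReal.ofReal_add (by positivity) hc0,
          ENNReal.ofReal_mul (by positivity)]
        gcongr

/-- The mean squared error of the estimator before the update at iteration `n + 1` decays like
`n^{-1/3}`. -/
theorem Assumptions.lintegral_estimator_decay (h : Assumptions P f A b X Lf σf) (h0 : 0 ≤ a)
    (ha : ∀ ξ, ‖A ξ‖ ≤ a) (hD0 : 0 ≤ D) (hD : ∀ x ∈ X, ∀ y ∈ X, ‖x - y‖ ≤ D)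
    (hs : IsFeasible P A b X xstar) (hβ : 0 < β₀) (hlmo : IsLMO X lmo) (hlm : Measurable lmo)
    (hξ : ∀ k, Measurable (ξ k)) (hmap : ∀ k, μ.map (ξ k) = P) (hind : iIndepFun ξ μ)
    {p : Vec d × Vec d} (hp : p.1 ∈ X) {Q : ℝ}
    (hQ₁ : 5 * ‖p.2 - meanGrad P f A b (betaSeq β₀ 1) p.1‖ ^ 2 ≤ Q)
    (hQ₂ : 18 * (2 * σf ^ 2 + 8 * (a ^ 2 * D / β₀) ^ 2) +
      (6 * (Lf + a ^ 2 / β₀) * D + 3 * a ^ 2 * D / β₀) ^ 2 ≤ Q) (n : ℕ) :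
    ∫⁻ ω, ENNReal.ofReal (‖(chain f A b lmo β₀ (fun i => ξ i ω) 1 p n).2 -
      meanGrad P f A b (betaSeq β₀ (n + 1))
        (chain f A b lmo β₀ (fun i => ξ i ω) 1 p n).1‖ ^ 2) ∂μ ≤
    ENNReal.ofReal (Q / sixth ((n + 1 : ℕ) + 4) ^ 2) := by
  set V := 2 * σf ^ 2 + 8 * (a ^ 2 * D / β₀) ^ 2 with hV
  set B := 6 * (Lf + a ^ 2 / β₀) * D + 3 * a ^ 2 * D / β₀ with hB
  have hV0 : 0 ≤ V := by positivity
  have hQ0 : 0 ≤ Q := le_trans (by positivity) hQ₂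
  induction n with
  | zero =>
    simp only [chain, lintegral_const, measure_univ, mul_one]
    refine ENNReal.ofReal_le_ofReal ?_
    -- At the start the denominator is `5^{1/3}`, crudely at most `5`; hence the factor `5` in
    -- `hQ₁`.
    have e1 : (1 : ℝ) ≤ sixth (((0 + 1 : ℕ) : ℝ) + 4) := one_le_sixth (by norm_num)
    have e2 : sixth (((0 + 1 : ℕ) : ℝ) + 4) ^ 2 ≤ 5 := by
      calc _ ≤ sixth (((0 + 1 : ℕ) : ℝ) + 4) ^ 6 := pow_le_pow_right₀ e1 (by norm_num)
        _ = 5 := by rw [sixth_pow (by positivity)]; norm_num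
    rw [le_div_iff₀ (by positivity)]
    refine le_trans ?_ hQ₁
    rw [mul_comm 5]
    gcongr
  | succ n ih =>
    have hk : 1 ≤ n + 1 := by lia
    have hτ := sixth_pos (by positivity : (0 : ℝ) < (n + 1 : ℕ) + 5)
    have hσ := sixth_pos (by positivity : (0 : ℝ) < (n + 1 : ℕ) + 4)
    have h1 := h.lintegral_estimator_le h0 ha hD hs hβ hlmo hlm hξ hmap hind hp n ih
      (by positivity)
    set ρ := rho (n + 1) with hρ
    have hρ0 : 0 < ρ := rho_pos _
    have hρ1 : ρ ≤ 1 := rho_le_one hk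
    set τ := sixth ((n + 1 : ℕ) + 5) with hτdef
    set e := Q / sixth ((n + 1 : ℕ) + 4) ^ 2 with he
    have he0 : 0 ≤ e := by positivity
    have hpt : ∀ ω, ENNReal.ofReal (‖(chain f A b lmo β₀ (fun i => ξ i ω) 1 p (n + 1)).2 -
        meanGrad P f A b (betaSeq β₀ (n + 1 + 1))
          (chain f A b lmo β₀ (fun i => ξ i ω) 1 p (n + 1)).1‖ ^ 2) ≤
        ENNReal.ofReal (1 + ρ) *
          ENNReal.ofReal (‖(chain f A b lmo β₀ (fun i => ξ i ω) 1 p (n + 1)).2 -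
            meanGrad P f A b (betaSeq β₀ (n + 1))
              (chain f A b lmo β₀ (fun i => ξ i ω) 1 p n).1‖ ^ 2) +
        ENNReal.ofReal ((1 + 1 / ρ) * (B / τ ^ 5) ^ 2) := by
      intro ω
      have hmem := chain_fst_mem (f := f) (A := A) (b := b) (β₀ := β₀) h.X_convex hlmo hp
        (fun i => ξ i ω) n
      have h2 := h.norm_meanGrad_step_sub_le h0 ha hD0 hD hs hβ hlmo hk hmem (ξ (n + 1) ω)
      rw [← chain_succ (fun i => ξ i ω)] at h2
      rw [← ENNReal.ofReal_mul (by positivity), ← ENNReal.ofReal_add (by positivity)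
        (by positivity)]
      refine ENNReal.ofReal_le_ofReal ?_
      rw [← sub_add_sub_cancel _ (meanGrad P f A b (betaSeq β₀ (n + 1))
        (chain f A b lmo β₀ (fun i => ξ i ω) 1 p n).1)]
      refine (sq_norm_add_le_of_pos hρ0 _ _).trans ?_
      gcongr
    refine (lintegral_mono hpt).trans ?_
    rw [lintegral_add_right _ measurable_const, lintegral_const_mul' _ _ ENNReal.ofReal_ne_top,
      lintegral_const, measure_univ, mul_one]
    refine (add_le_add (mul_le_mul_right h1 _) le_rfl).trans ?_
    rw [← ENNReal.ofReal_mul (by positivity), ← ENNReal.ofReal_add (by positivity)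
        (by positivity)]
    refine ENNReal.ofReal_le_ofReal ?_
    have hrec := estimator_recursion hQ₂ hQ0 hk
    have hcast : (((n + 1 + 1 : ℕ) : ℝ) + 4) = ((n + 1 : ℕ) : ℝ) + 5 := by push_cast; ring
    rw [hcast]
    refine le_trans ?_ hrec
    -- Young's inequality with weight `ρ` costs one of the two contraction factors. In `t3`, the
    -- opposite weight `1 + 1/ρ` is at most `τ ^ 4`, which brings the squared drift to order `τ ^
    -- (-6)`, the same as the noise.
    have t1 : (1 + ρ) * ((1 - ρ) ^ 2 * e) ≤ (1 - ρ) * e := by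
      have : (1 + ρ) * ((1 - ρ) ^ 2 * e) = (1 - ρ ^ 2) * ((1 - ρ) * e) := by ring
      rw [this]
      exact mul_le_of_le_one_left (mul_nonneg (by linarith) he0) (by linarith [sq_nonneg ρ])
    have t2 : (1 + ρ) * (9 * V / τ ^ 6) ≤ 18 * V / τ ^ 6 := by
      calc _ ≤ 2 * (9 * V / τ ^ 6) := by gcongr; linarith
        _ = _ := by ring
    have t3 : (1 + 1 / ρ) * (B / τ ^ 5) ^ 2 ≤ B ^ 2 / τ ^ 6 := by
      have : 1 + 1 / ρ ≤ τ ^ 4 := by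
        have e1 : 1 / ρ = τ ^ 4 / 3 := by rw [hρ, rho_eq, one_div_div]
        have e2 : 1 ≤ 1 / ρ := by rw [le_div_iff₀ hρ0]; linarith
        linarith
      calc _ ≤ τ ^ 4 * (B / τ ^ 5) ^ 2 := by gcongr
        _ = _ := by field_simp
    rw [mul_add]
    calc _ ≤ (1 - ρ) * e + 18 * V / τ ^ 6 + B ^ 2 / τ ^ 6 := by linarith
      _ = (1 - ρ) * e + (18 * V + B ^ 2) / τ ^ 6 := by ring

end Convergence

/-! ### The Frank–Wolfe recursion and the convergence rates -/

section Rates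

variable {Ξ : Type*} [MeasurableSpace Ξ] {P : Measure Ξ} {d m : ℕ}
  {f : Vec d → Ξ → ℝ} {A : Ξ → Vec d →L[ℝ] Vec m} {b : Ξ → Set (Vec m)} {X : Set (Vec d)}
  {Lf : ℝ≥0} {σf : ℝ} {lmo : Vec d → Vec d} {β₀ : ℝ} {a D : ℝ} {xstar : Vec d}
  [IsProbabilityMeasure P]

/-- One Frank–Wolfe step, in terms of the error of the gradient estimator. -/
theorem Assumptions.smoothedObjective_step_le (h : Assumptions P f A b X Lf σf)
    (ha : ∀ ξ, ‖A ξ‖ ≤ a) (hD : ∀ x ∈ X, ∀ y ∈ X, ‖x - y‖ ≤ D)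
    (hs : IsFeasible P A b X xstar) (hβ : 0 < β₀) (hlmo : IsLMO X lmo) (n : ℕ)
    {p : Vec d × Vec d} (hp : p.1 ∈ X) (ζ : Ξ) :
    smoothedObjective P f A b (betaSeq β₀ (n + 1)) (step f A b lmo β₀ (n + 1) p ζ).1 -
        objective P f xstar ≤
      (1 - gam (n + 1)) *
        (smoothedObjective P f A b (betaSeq β₀ n) p.1 - objective P f xstar) +
      gam (n + 1) * (D * ‖(step f A b lmo β₀ (n + 1) p ζ).2 -
        meanGrad P f A b (betaSeq β₀ (n + 1)) p.1‖) +
      gam (n + 1) * (2 * (Lf + a ^ 2 / β₀) * D ^ 2 / sixth ((n + 1 : ℕ))) := by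
  have hk : 1 ≤ n + 1 := by lia
  have hβk := betaSeq_pos hβ (n + 1)
  have hγ := (gam_mem_Icc hk).1
  have hdesc := h.smoothedObjective_le ha hs hβk hp (step f A b lmo β₀ (n + 1) p ζ).1
  have hnorm := norm_step_sub_le (f := f) (A := A) (b := b) (β₀ := β₀) hD hlmo hk hp ζ
  have hgrad := h.inner_meanGrad_le hs hβk hp
  have habs := one_sub_two_gam_mul_le hβ hk
  have hκ : 0 < sixth ((n + 1 : ℕ) : ℝ) := sixth_pos (by positivity)
  set M := meanGrad P f A b (betaSeq β₀ (n + 1)) p.1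
  set e := estimator f A b β₀ (n + 1) p ζ with he
  have hstep2 : (step f A b lmo β₀ (n + 1) p ζ).2 = e := rfl
  have hstep1 : (step f A b lmo β₀ (n + 1) p ζ).1 - p.1 = gam (n + 1) • (lmo e - p.1) := by
    rw [step, add_sub_cancel_left]
  -- The oracle minimises against `e`, not `M`. Comparing with `xstar` and exchanging `e` for `M`
  -- costs the estimation error times the diameter.
  have hlin : inner ℝ M (lmo e - p.1) ≤ objective P f xstar - objective P f p.1 -
      infeas P A b p.1 / betaSeq β₀ (n + 1) + D * ‖e - M‖ := by
    have h1 := (hlmo e).2 xstar hs.1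
    have h2 : inner ℝ (M - e) (lmo e - xstar) ≤ D * ‖e - M‖ := by
      refine (real_inner_le_norm _ _).trans ?_
      rw [norm_sub_rev, mul_comm]
      gcongr
      exact hD _ (hlmo e).1 _ hs.1
    have h3 : inner ℝ M (lmo e - p.1) = inner ℝ M (xstar - p.1) +
        inner ℝ (M - e) (lmo e - xstar) + (inner ℝ (lmo e) e - inner ℝ xstar e) := by
      rw [real_inner_comm e, real_inner_comm e xstar, ← inner_sub_right, add_assoc,
        ← inner_add_left, sub_add_cancel, ← inner_add_right]
      congr 1; abel
    linarith
  have hquad : (Lf + a ^ 2 / betaSeq β₀ (n + 1)) *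
      ‖(step f A b lmo β₀ (n + 1) p ζ).1 - p.1‖ ^ 2 ≤
      gam (n + 1) * (2 * (Lf + a ^ 2 / β₀) * D ^ 2 / sixth ((n + 1 : ℕ))) := by
    set t : ℝ := ((n + 1 : ℕ) : ℝ) + 1 with ht
    have ht1 : 1 ≤ t := by rw [ht]; push_cast; linarith [n.cast_nonneg (α := ℝ)]
    have hτ1 : 1 ≤ sixth t := one_le_sixth ht1
    have hκτ : sixth ((n + 1 : ℕ) : ℝ) ≤ sixth t := sixth_mono (by positivity) (by linarith)
    have e1 : (Lf : ℝ) + a ^ 2 / betaSeq β₀ (n + 1) ≤ (Lf + a ^ 2 / β₀) * sixth t := by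
      rw [add_mul, betaSeq_eq]
      refine add_le_add (le_mul_of_one_le_right Lf.2 hτ1) (le_of_eq ?_)
      rw [← ht]; field_simp
    have e2 : gam (n + 1) * sixth t ≤ 2 / sixth ((n + 1 : ℕ) : ℝ) := by
      have e3 : sixth t * sixth ((n + 1 : ℕ) : ℝ) ≤ t := by
        calc _ ≤ sixth t ^ 2 := by rw [sq]; gcongr
          _ ≤ sixth t ^ 6 := pow_le_pow_right₀ hτ1 (by norm_num)
          _ = t := sixth_pow (by linarith)
      rw [gam, ← ht, le_div_iff₀ hκ, mul_assoc, div_mul_eq_mul_div, div_le_iff₀ (by linarith)]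
      gcongr
    calc _ ≤ ((Lf + a ^ 2 / β₀) * sixth t) * (gam (n + 1) * D) ^ 2 := by gcongr
      _ = gam (n + 1) * ((Lf + a ^ 2 / β₀) * D ^ 2 * (gam (n + 1) * sixth t)) := by ring
      _ ≤ gam (n + 1) * ((Lf + a ^ 2 / β₀) * D ^ 2 * (2 / sixth ((n + 1 : ℕ) : ℝ))) := by gcongr
      _ = _ := by ring
  have hlin' := mul_le_mul_of_nonneg_left hlin hγ
  rw [hstep2]
  rw [hstep1, inner_smul_right, ← hstep1] at hdesc
  -- After the step the infeasibility has coefficient `(1 - 2γ)/(2β_k)`; this replaces it by `(1 -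
  -- γ)/(2β_{k-1})`, the one in the contracted previous gap.
  have hh := mul_le_mul_of_nonneg_right habs (infeas_nonneg (P := P) (A := A) (b := b) p.1)
  have r1 : smoothedObjective P f A b (betaSeq β₀ (n + 1)) p.1 = objective P f p.1 +
      1 / betaSeq β₀ (n + 1) * infeas P A b p.1 / 2 := by
    rw [smoothedObjective]; field_simp
  have r2 : smoothedObjective P f A b (betaSeq β₀ n) p.1 = objective P f p.1 +
      sixth ((n + 1 : ℕ)) / β₀ * infeas P A b p.1 / 2 := by
    rw [smoothedObjective, betaSeq_eq]; push_cast
    have : 0 < sixth ((n : ℝ) + 1) := sixth_pos (by positivity)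
    field_simp
  rw [r1] at hdesc
  rw [r2]
  have r3 : infeas P A b p.1 / betaSeq β₀ (n + 1) =
      1 / betaSeq β₀ (n + 1) * infeas P A b p.1 := by ring
  rw [r3] at hlin'
  nlinarith

omit [IsProbabilityMeasure P] in
theorem Assumptions.exists_abs_objective_le (h : Assumptions P f A b X Lf σf) :
    ∃ B : ℝ, ∀ x ∈ X, |objective P f x| ≤ B := by
  obtain ⟨B, hB⟩ := h.X_compact.exists_bound_of_continuousOn h.continuous_objective.continuousOn
  exact ⟨B, fun x hx => by simpa using hB x hx⟩

variable {Ω : Type*} [MeasurableSpace Ω] {μ : Measure Ω} [IsProbabilityMeasure μ]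
  {ξ : ℕ → Ω → Ξ}

omit [IsProbabilityMeasure P] in
theorem Assumptions.integrable_objective_comp (h : Assumptions P f A b X Lf σf)
    {x : Ω → Vec d} (hx : Measurable x) (hxX : ∀ ω, x ω ∈ X) :
    Integrable (fun ω => objective P f (x ω)) μ := by
  obtain ⟨B, hB⟩ := h.exists_abs_objective_le
  exact Integrable.of_bound (h.continuous_objective.measurable.comp hx).aestronglyMeasurable B
    (Filter.Eventually.of_forall fun ω => hB _ (hxX ω))

theorem Assumptions.integrable_infeas_comp (h : Assumptions P f A b X Lf σf) (h0 : 0 ≤ a)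
    (ha : ∀ ξ, ‖A ξ‖ ≤ a) (hD : ∀ x ∈ X, ∀ y ∈ X, ‖x - y‖ ≤ D) (hs : IsFeasible P A b X xstar)
    {x : Ω → Vec d} (hx : Measurable x) (hxX : ∀ ω, x ω ∈ X) :
    Integrable (fun ω => infeas P A b (x ω)) μ := by
  refine Integrable.of_bound (h.measurable_infeas.comp hx).aestronglyMeasurable ((a * D) ^ 2)
    (Filter.Eventually.of_forall fun ω => ?_)
  rw [Real.norm_of_nonneg (infeas_nonneg _)]
  exact h.infeas_le h0 ha hD hs (hxX ω)

theorem Assumptions.integrable_sq_infDist_prod (h : Assumptions P f A b X Lf σf) (h0 : 0 ≤ a)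
    (ha : ∀ ξ, ‖A ξ‖ ≤ a) (hD : ∀ x ∈ X, ∀ y ∈ X, ‖x - y‖ ≤ D) (hs : IsFeasible P A b X xstar)
    {x : Ω → Vec d} (hx : Measurable x) (hxX : ∀ ω, x ω ∈ X) :
    Integrable (fun p : Ω × Ξ => Metric.infDist (A p.2 (x p.1)) (b p.2) ^ 2) (μ.prod P) := by
  have hm : Measurable fun p : Ω × Ξ => (x p.1, p.2) :=
    (hx.comp measurable_fst).prodMk measurable_snd
  refine Integrable.of_bound (h.measurable_sq_infDist.comp hm).aestronglyMeasurable
    ((a * D) ^ 2) ?_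
  filter_upwards [Measure.quasiMeasurePreserving_snd.ae hs.2] with p hp
  have h1 := (infDist_apply_le ha hp (x p.1)).trans
    (mul_le_mul_of_nonneg_left (hD _ (hxX p.1) _ hs.1) h0)
  have h2 := Metric.infDist_nonneg (x := A p.2 (x p.1)) (s := b p.2)
  rw [Real.norm_of_nonneg (sq_nonneg _)]
  gcongr

/-- The expected gap of the smoothed objective decays like `n^{-1/6}`. -/
theorem Assumptions.integral_gap_le (h : Assumptions P f A b X Lf σf) (h0 : 0 ≤ a)
    (ha : ∀ ξ, ‖A ξ‖ ≤ a) (hD0 : 0 ≤ D) (hD : ∀ x ∈ X, ∀ y ∈ X, ‖x - y‖ ≤ D)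
    (hs : IsFeasible P A b X xstar) (hβ : 0 < β₀) (hlmo : IsLMO X lmo) (hlm : Measurable lmo)
    (hξ : ∀ k, Measurable (ξ k)) (hmap : ∀ k, μ.map (ξ k) = P) (hind : iIndepFun ξ μ)
    {p : Vec d × Vec d} (hp : p.1 ∈ X) {Q K : ℝ}
    (hQ₁ : 5 * ‖p.2 - meanGrad P f A b (betaSeq β₀ 1) p.1‖ ^ 2 ≤ Q)
    (hQ₂ : 18 * (2 * σf ^ 2 + 8 * (a ^ 2 * D / β₀) ^ 2) +
      (6 * (Lf + a ^ 2 / β₀) * D + 3 * a ^ 2 * D / β₀) ^ 2 ≤ Q)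
    (hK₁ : smoothedObjective P f A b (betaSeq β₀ 0) p.1 - objective P f xstar ≤ K)
    (hK₂ : 2 * (D * (2 * Q + 1) + 2 * (Lf + a ^ 2 / β₀) * D ^ 2) ≤ K) (n : ℕ) :
    ∫ ω, (smoothedObjective P f A b (betaSeq β₀ n)
      (chain f A b lmo β₀ (fun i => ξ i ω) 1 p n).1 - objective P f xstar) ∂μ ≤
      K / sixth (n + 1 : ℕ) := by
  have hQ0 : 0 ≤ Q := le_trans (by positivity) hQ₁
  have hK0 : 0 ≤ K := le_trans (by positivity) hK₂
  have hmem : ∀ n ω, (chain f A b lmo β₀ (fun i => ξ i ω) 1 p n).1 ∈ X := fun n ω =>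
    chain_fst_mem h.X_convex hlmo hp _ n
  have hmeas : ∀ n, Measurable fun ω => chain f A b lmo β₀ (fun i => ξ i ω) 1 p n :=
    h.measurable_chain hlm hξ p
  have hint : ∀ n, Integrable (fun ω => smoothedObjective P f A b (betaSeq β₀ n)
      (chain f A b lmo β₀ (fun i => ξ i ω) 1 p n).1 - objective P f xstar) μ := fun n =>
    ((h.integrable_objective_comp (hmeas n).fst (hmem n)).add
      ((h.integrable_infeas_comp h0 ha hD hs (hmeas n).fst (hmem n)).const_mul _)).sub
      (integrable_const _)
  induction n with
  | zero =>
    simp only [chain, integral_const, probReal_univ, one_smul, zero_add, Nat.cast_one, sixth_one,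
      div_one]
    exact hK₁
  | succ n ih =>
    have hk : 1 ≤ n + 1 := by lia
    have hκ := sixth_pos (by positivity : (0 : ℝ) < (n + 1 : ℕ))
    obtain ⟨hγ0, hγ1⟩ := gam_mem_Icc hk
    have hest := h.lintegral_estimator_le h0 ha hD hs hβ hlmo hlm hξ hmap hind hp n
      (h.lintegral_estimator_decay h0 ha hD0 hD hs hβ hlmo hlm hξ hmap hind hp hQ₁ hQ₂ n)
      (by have := sixth_pos (by positivity : (0 : ℝ) < (n + 1 : ℕ) + 4); positivity)
    have hΔ : (1 - rho (n + 1)) ^ 2 * (Q / sixth ((n + 1 : ℕ) + 4) ^ 2) +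
        9 * (2 * σf ^ 2 + 8 * (a ^ 2 * D / β₀) ^ 2) / sixth ((n + 1 : ℕ) + 5) ^ 6 ≤
        2 * Q / sixth (n + 1 : ℕ) ^ 2 := by
      have e1 : sixth ((n + 1 : ℕ) : ℝ) ≤ sixth ((n + 1 : ℕ) + 4) :=
        sixth_mono (by positivity) (by linarith)
      have e2 : sixth ((n + 1 : ℕ) : ℝ) ≤ sixth ((n + 1 : ℕ) + 5) :=
        sixth_mono (by positivity) (by linarith)
      have e3 : 1 ≤ sixth (((n + 1 : ℕ) : ℝ) + 5) :=
        one_le_sixth (by linarith [(n + 1).cast_nonneg (α := ℝ)])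
      have e4 : sixth ((n + 1 : ℕ) : ℝ) ^ 2 ≤ sixth ((n + 1 : ℕ) + 5) ^ 6 :=
        (pow_le_pow_left₀ hκ.le e2 2).trans (pow_le_pow_right₀ e3 (by norm_num))
      have e5 : (1 - rho (n + 1)) ^ 2 ≤ 1 :=
        pow_le_one₀ (by linarith [rho_le_one hk]) (by linarith [rho_pos (n + 1)])
      have e6 : 9 * (2 * σf ^ 2 + 8 * (a ^ 2 * D / β₀) ^ 2) ≤ Q := by
        refine le_trans ?_ hQ₂
        have e7 : 0 ≤ 2 * σf ^ 2 + 8 * (a ^ 2 * D / β₀) ^ 2 := by positivity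
        have e8 := sq_nonneg (6 * (Lf + a ^ 2 / β₀) * D + 3 * a ^ 2 * D / β₀)
        linarith
      calc _ ≤ 1 * (Q / sixth (n + 1 : ℕ) ^ 2) + Q / sixth (n + 1 : ℕ) ^ 2 := by gcongr
        _ = _ := by ring
    have hme : Measurable fun ω => ‖(chain f A b lmo β₀ (fun i => ξ i ω) 1 p (n + 1)).2 -
        meanGrad P f A b (betaSeq β₀ (n + 1))
          (chain f A b lmo β₀ (fun i => ξ i ω) 1 p n).1‖ :=
      ((hmeas (n + 1)).snd.sub ((h.measurable_meanGrad _).comp (hmeas n).fst)).norm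
    -- The second moment is of order `κ⁻²` with `κ = (n+1)^{1/6}`, so the weight `κ` balances both
    -- terms of the first-moment bound at order `1/κ`.
    obtain ⟨hei, hele⟩ := integral_le_of_lintegral_sq_le hme (fun ω => norm_nonneg _)
      (by positivity) hκ (hest.trans (ENNReal.ofReal_le_ofReal hΔ))
    have hele' : ∫ ω, ‖(chain f A b lmo β₀ (fun i => ξ i ω) 1 p (n + 1)).2 -
        meanGrad P f A b (betaSeq β₀ (n + 1))
          (chain f A b lmo β₀ (fun i => ξ i ω) 1 p n).1‖ ∂μ ≤
        (2 * Q + 1) / sixth (n + 1 : ℕ) := hele.trans_eq (by field_simp)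
    have hpt := fun ω => h.smoothedObjective_step_le ha hD hs hβ hlmo n (hmem n ω)
      (ξ (n + 1) ω)
    simp only [← chain_succ (fun i => ξ i _)] at hpt
    have i1 := (hint n).const_mul (1 - gam (n + 1))
    have i2 := (hei.const_mul D).const_mul (gam (n + 1))
    refine (integral_mono (hint (n + 1)) ((i1.fun_add i2).fun_add (integrable_const _))
      hpt).trans ?_
    rw [integral_add (i1.fun_add i2) (integrable_const _), integral_add i1 i2,
      integral_const_mul, integral_const_mul, integral_const_mul]
    simp only [integral_const, probReal_univ, one_smul]
    have hgap := gap_recursion hK₂ hK0 hk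
    rw [← Nat.cast_succ] at hgap
    refine le_trans ?_ hgap
    have hsplit : gam (n + 1) * ((D * (2 * Q + 1) + 2 * (Lf + a ^ 2 / β₀) * D ^ 2) /
        sixth (n + 1 : ℕ)) = gam (n + 1) * (D * ((2 * Q + 1) / sixth (n + 1 : ℕ))) +
        gam (n + 1) * (2 * (Lf + a ^ 2 / β₀) * D ^ 2 / sixth (n + 1 : ℕ)) := by ring
    rw [hsplit, ← add_assoc]
    refine add_le_add (add_le_add ?_ ?_) le_rfl
    · exact mul_le_mul_of_nonneg_left ih (by linarith)
    · gcongr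

/-- H-1SFW converges at the rate `k^{-1/6}`, in objective value and in infeasibility. -/
theorem Assumptions.exists_rate (h : Assumptions P f A b X Lf σf)
    (hs : IsSolution P f A b X xstar) (hβ : 0 < β₀) {p : Vec d × Vec d} (hp : p.1 ∈ X) :
    ∃ C : ℝ, 1 ≤ C ∧ ∀ lmo : Vec d → Vec d, IsLMO X lmo → Measurable lmo →
      ∀ {Ω : Type*} [MeasurableSpace Ω] (μ : Measure Ω) [IsProbabilityMeasure μ]
        (ξ : ℕ → Ω → Ξ), (∀ k, Measurable (ξ k)) → (∀ k, μ.map (ξ k) = P) → iIndepFun ξ μ →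
      ∀ n : ℕ, IsEpsSolution P f A b (objective P f xstar) μ
        (fun ω => (chain f A b lmo β₀ (fun i => ξ i ω) 1 p n).1) (C / sixth (n + 1 : ℕ)) := by
  obtain ⟨a, h0, ha⟩ := h.exists_norm_le
  obtain ⟨D, hD'⟩ := Metric.isBounded_iff.1 h.X_compact.isBounded
  have hD : ∀ x ∈ X, ∀ y ∈ X, ‖x - y‖ ≤ D := fun x hx y hy => by
    rw [← dist_eq_norm]; exact hD' hx hy
  have hD0 : 0 ≤ D := (norm_nonneg _).trans (hD _ hp _ hp)
  obtain ⟨M, hM0, hM⟩ := h.exists_objective_sub_le hs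
  -- The constants are fixed before the oracle, the probability space and the samples are
  -- introduced, so the final constant does not depend on them.
  set Q := 5 * ‖p.2 - meanGrad P f A b (betaSeq β₀ 1) p.1‖ ^ 2 +
    (18 * (2 * σf ^ 2 + 8 * (a ^ 2 * D / β₀) ^ 2) +
      (6 * (Lf + a ^ 2 / β₀) * D + 3 * a ^ 2 * D / β₀) ^ 2) with hQ
  have hQ₁ : 5 * ‖p.2 - meanGrad P f A b (betaSeq β₀ 1) p.1‖ ^ 2 ≤ Q :=
    le_add_of_nonneg_right (by positivity)
  have hQ₂ : 18 * (2 * σf ^ 2 + 8 * (a ^ 2 * D / β₀) ^ 2) +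
      (6 * (Lf + a ^ 2 / β₀) * D + 3 * a ^ 2 * D / β₀) ^ 2 ≤ Q :=
    le_add_of_nonneg_left (by positivity)
  have hQ0 : 0 ≤ Q := le_trans (by positivity) hQ₁
  set K := max (smoothedObjective P f A b (betaSeq β₀ 0) p.1 - objective P f xstar)
    (2 * (D * (2 * Q + 1) + 2 * (Lf + a ^ 2 / β₀) * D ^ 2)) with hK
  have hK0 : 0 ≤ K := le_max_of_le_right (by positivity)
  set W := K + 2 * M ^ 2 * β₀ with hW
  have hW0 : 0 ≤ W := by positivity
  -- `W` serves the objective and the square root the infeasibility; the summand `1` makes the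
  -- constant at least `1`, so that its sixth power dominates it.
  refine ⟨1 + W + √(4 * β₀ * W), by linarith [Real.sqrt_nonneg (4 * β₀ * W)], ?_⟩
  intro lmo hlmo hlm Ω _ μ _ ξ hξ hmap hind n
  have hgap := h.integral_gap_le h0 ha hD0 hD hs.1 hβ hlmo hlm hξ hmap hind hp hQ₁ hQ₂
    (le_max_left _ _) (le_max_right _ _) n
  rw [← hK] at hgap
  set x : Ω → Vec d := fun ω => (chain f A b lmo β₀ (fun i => ξ i ω) 1 p n).1 with hxdef
  have hxX : ∀ ω, x ω ∈ X := fun ω => chain_fst_mem h.X_convex hlmo hp _ n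
  have hxm : Measurable x := (h.measurable_chain hlm hξ p n).fst
  have hκ := sixth_pos (by positivity : (0 : ℝ) < (n + 1 : ℕ))
  set κ := sixth ((n + 1 : ℕ) : ℝ) with hκdef
  set β := betaSeq β₀ n with hβdef
  have hβκ : β = β₀ / κ := by rw [hβdef, betaSeq_eq, hκdef, Nat.cast_succ]
  have hβpos : 0 < β := betaSeq_pos hβ n
  have iF := h.integrable_objective_comp (μ := μ) hxm hxX
  have iH := h.integrable_infeas_comp (μ := μ) h0 ha hD hs.1 hxm hxX
  have iG : Integrable (fun ω => smoothedObjective P f A b β (x ω) - objective P f xstar) μ :=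
    (iF.add (iH.const_mul _)).sub (integrable_const _)
  -- Young's inequality applied to the duality bound `M s`, with the weight chosen to use exactly
  -- half of the penalty `s²/(2β)`.
  have hlow : ∀ ω, -(infeas P A b (x ω) / (4 * β) + M ^ 2 * β) ≤
      objective P f (x ω) - objective P f xstar := by
    intro ω
    have h1 := hM _ (hxX ω)
    change _ ≤ M * √(infeas P A b (x ω)) at h1
    have h2 := Real.sq_sqrt (infeas_nonneg (P := P) (A := A) (b := b) (x ω))
    set s := √(infeas P A b (x ω))
    have h3 : infeas P A b (x ω) / (4 * β) + M ^ 2 * β - M * s =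
        (s - 2 * β * M) ^ 2 / (4 * β) := by
      rw [← h2]; field_simp; ring
    have h4 : 0 ≤ (s - 2 * β * M) ^ 2 / (4 * β) := by positivity
    linarith
  have hsm : ∀ ω, smoothedObjective P f A b β (x ω) = objective P f (x ω) +
      2 * (infeas P A b (x ω) / (4 * β)) := fun ω => by
    rw [smoothedObjective]; field_simp; ring
  have hnn : ∀ ω, 0 ≤ infeas P A b (x ω) / (4 * β) := fun ω => by
    have := infeas_nonneg (P := P) (A := A) (b := b) (x ω)
    positivity
  have hsum : K / κ + 2 * (M ^ 2 * β) = W / κ := by rw [hβκ, hW]; ring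
  have hCW : W / κ ≤ (1 + W + √(4 * β₀ * W)) / κ := by
    gcongr
    linarith [Real.sqrt_nonneg (4 * β₀ * W)]
  refine ⟨⟨(iF.sub (integrable_const _)).abs, le_trans ?_ hCW⟩,
    h.integrable_sq_infDist_prod h0 ha hD hs.1 hxm hxX, ?_⟩
  · calc ∫ ω, |objective P f (x ω) - objective P f xstar| ∂μ
        ≤ ∫ ω, ((smoothedObjective P f A b β (x ω) - objective P f xstar)
          + 2 * (M ^ 2 * β)) ∂μ := by
          refine integral_mono (iF.sub (integrable_const _)).abs
            (iG.add (integrable_const _)) fun ω => ?_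
          have h1 := hlow ω
          have h2 := hnn ω
          have h3 : 0 ≤ M ^ 2 * β := by positivity
          rw [hsm, abs_le]
          constructor <;> linarith
      _ ≤ K / κ + 2 * (M ^ 2 * β) := by
          rw [integral_add iG (integrable_const _)]
          simp only [integral_const, probReal_univ, one_smul]
          gcongr
      _ = W / κ := hsum
  · rw [integral_prod _ (h.integrable_sq_infDist_prod h0 ha hD hs.1 hxm hxX)]
    change √(∫ ω, infeas P A b (x ω) ∂μ) ≤ _
    have h1 : ∫ ω, infeas P A b (x ω) ∂μ ≤ 4 * β₀ * W / κ ^ 2 := by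
      calc ∫ ω, infeas P A b (x ω) ∂μ
          ≤ ∫ ω, 4 * β * ((smoothedObjective P f A b β (x ω) - objective P f xstar)
            + 2 * (M ^ 2 * β)) ∂μ := by
            refine integral_mono iH ((iG.fun_add (integrable_const _)).const_mul _) fun ω => ?_
            have h1 := hlow ω
            have h3 : 0 ≤ M ^ 2 * β := by positivity
            have h4 : infeas P A b (x ω) = 4 * β * (infeas P A b (x ω) / (4 * β)) := by
              field_simp
            rw [hsm]
            dsimp only
            conv_lhs => rw [h4]
            gcongr
            linarith
        _ ≤ 4 * β * (K / κ + 2 * (M ^ 2 * β)) := by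
            rw [integral_const_mul, integral_add iG (integrable_const _)]
            simp only [integral_const, probReal_univ, one_smul]
            gcongr
        _ = 4 * β₀ * W / κ ^ 2 := by rw [hsum, hβκ]; ring
    calc √(∫ ω, infeas P A b (x ω) ∂μ) ≤ √(4 * β₀ * W / κ ^ 2) := Real.sqrt_le_sqrt h1
      _ = √(4 * β₀ * W) / κ := by rw [Real.sqrt_div' _ (sq_nonneg κ), Real.sqrt_sq hκ.le]
      _ ≤ _ := by gcongr; linarith

end Rates

theorem IsEpsSolution.mono {Ξ : Type*} [MeasurableSpace Ξ] {d m : ℕ} {P : Measure Ξ}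
    {f : Vec d → Ξ → ℝ} {A : Ξ → Vec d →L[ℝ] Vec m} {b : Ξ → Set (Vec m)} {fstar : ℝ}
    {Ω : Type*} [MeasurableSpace Ω] {μ : Measure Ω} {x : Ω → Vec d} {ε ε' : ℝ}
    (h : IsEpsSolution P f A b fstar μ x ε) (hε : ε ≤ ε') :
    IsEpsSolution P f A b fstar μ x ε' :=
  ⟨⟨h.1.1, h.1.2.trans hε⟩, h.2.1, h.2.2.trans hε⟩

end HSFW

end

/-! ### Rates and oracle complexity -/

theorem corollary1 {Ξ : Type*} [MeasurableSpace Ξ] (P : Measure Ξ) [IsProbabilityMeasure P]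
    {d m : ℕ} (f : HSFW.Vec d → Ξ → ℝ) (A : Ξ → HSFW.Vec d →L[ℝ] HSFW.Vec m)
    (b : Ξ → Set (HSFW.Vec m)) (X : Set (HSFW.Vec d)) (Lf : ℝ≥0) (σf : ℝ)
    (hprob : HSFW.Assumptions P f A b X Lf σf)
    (xstar : HSFW.Vec d) (hxstar : HSFW.IsSolution P f A b X xstar)
    (β₀ : ℝ) (hβ₀ : 0 < β₀) (x₁ : HSFW.Vec d) (hx₁ : x₁ ∈ X) (d₀ : HSFW.Vec d) :
    ∃ C : ℝ, ∀ (lmo : HSFW.Vec d → HSFW.Vec d), HSFW.IsLMO X lmo → Measurable lmo →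
      ∀ {Ω : Type*} [MeasurableSpace Ω] (μ : Measure Ω) [IsProbabilityMeasure μ]
        (ξ : ℕ → Ω → Ξ), (∀ k, Measurable (ξ k)) → (∀ k, μ.map (ξ k) = P) → iIndepFun ξ μ →
      -- the objective converges at the rate `k^{-1/6}`
      (∀ k : ℕ, 1 ≤ k →
        Integrable (fun ω => |HSFW.objective P f
          (HSFW.iterate f A b lmo β₀ x₁ d₀ (fun i => ξ i ω) k) - HSFW.objective P f xstar|) μ ∧
        ∫ ω, |HSFW.objective P f
          (HSFW.iterate f A b lmo β₀ x₁ d₀ (fun i => ξ i ω) k) - HSFW.objective P f xstar| ∂μ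
            ≤ C * (k : ℝ) ^ (-(1 / 6) : ℝ)) ∧
      -- the root-mean-square infeasibility converges at the rate `k^{-1/6}`
      (∀ k : ℕ, 1 ≤ k →
        Integrable (fun p : Ω × Ξ => Metric.infDist
          (A p.2 (HSFW.iterate f A b lmo β₀ x₁ d₀ (fun i => ξ i p.1) k)) (b p.2) ^ 2)
            (μ.prod P) ∧
        Real.sqrt (∫ p : Ω × Ξ, Metric.infDist
          (A p.2 (HSFW.iterate f A b lmo β₀ x₁ d₀ (fun i => ξ i p.1) k)) (b p.2) ^ 2
            ∂(μ.prod P)) ≤ C * (k : ℝ) ^ (-(1 / 6) : ℝ)) ∧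
      -- an `ε`-solution is found with `O(ε^{-6})` calls of each oracle
      (∀ ε : ℝ, 0 < ε → ε ≤ 1 → ∃ n : ℕ,
        HSFW.IsEpsSolution P f A b (HSFW.objective P f xstar) μ
          (fun ω => (HSFW.h1sfw f A b lmo β₀ x₁ d₀ (fun i => ξ i ω) n).result) ε ∧
        ∀ ω, ((HSFW.h1sfw f A b lmo β₀ x₁ d₀ (fun i => ξ i ω) n).sfoCalls : ℝ)
              ≤ C * ε ^ (-6 : ℤ) ∧
            ((HSFW.h1sfw f A b lmo β₀ x₁ d₀ (fun i => ξ i ω) n).lmoCalls : ℝ)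
              ≤ C * ε ^ (-6 : ℤ)) := by
  obtain ⟨C, hC1, hC⟩ := hprob.exists_rate hxstar hβ₀ (p := (x₁, d₀)) hx₁
  have hC0 : 0 < C := one_pos.trans_le hC1
  have hC6 : C ≤ C ^ 6 := le_self_pow₀ hC1 (by norm_num)
  -- Inverting the rate `C k^{-1/6}` costs `(C/ε)⁶` iterations, and `C ≤ C ^ 6` lets one constant
  -- serve the rates and the counts.
  refine ⟨C ^ 6, fun lmo hlmo hlm Ω _ μ _ ξ hξ hmap hind => ?_⟩
  have hrate := hC lmo hlmo hlm μ ξ hξ hmap hind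
  have hiter : ∀ k : ℕ, 1 ≤ k → HSFW.IsEpsSolution P f A b (HSFW.objective P f xstar) μ
      (fun ω => HSFW.iterate f A b lmo β₀ x₁ d₀ (fun i => ξ i ω) k)
      (C ^ 6 * (k : ℝ) ^ (-(1 / 6) : ℝ)) := by
    intro k hk
    have h1 := hrate (k - 1)
    rw [Nat.sub_add_cancel hk] at h1
    simp only [HSFW.iterate, HSFW.h1sfw_eq]
    refine h1.mono ?_
    rw [HSFW.rpow_neg_sixth k.cast_nonneg, ← div_eq_mul_inv]
    exact div_le_div_of_nonneg_right hC6 (HSFW.sixth_pos (by positivity)).le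
  refine ⟨fun k hk => (hiter k hk).1, fun k hk => (hiter k hk).2, fun ε hε _ => ?_⟩
  have hpos : 0 < (C / ε) ^ 6 := by positivity
  -- `n` iterations return the iterate of index `n + 1`, so `n` is one less than the ceiling. This
  -- keeps the count below `(C/ε)⁶` with no additive term.
  obtain ⟨n, hn⟩ := Nat.exists_eq_succ_of_ne_zero (Nat.ceil_pos.2 hpos).ne'
  have hlow : (C / ε) ^ 6 ≤ (n + 1 : ℕ) := by
    rw [← Nat.succ_eq_add_one, ← hn]
    exact Nat.le_ceil _
  have hup : (n : ℝ) ≤ C ^ 6 * ε ^ (-6 : ℤ) := by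
    have h1 := Nat.ceil_lt_add_one hpos.le
    rw [hn, Nat.cast_succ] at h1
    have h2 : C ^ 6 * ε ^ (-6 : ℤ) = (C / ε) ^ 6 := by
      rw [zpow_neg, div_pow, div_eq_mul_inv]
      norm_cast
    rw [h2]
    linarith
  refine ⟨n, ?_, fun ω => ?_⟩
  · simp only [HSFW.h1sfw_eq]
    refine (hrate n).mono ?_
    have hκ : 0 < HSFW.sixth ((n + 1 : ℕ) : ℝ) := HSFW.sixth_pos (by positivity)
    rw [div_le_comm₀ hκ hε]
    refine le_of_pow_le_pow_left₀ (n := 6) (by norm_num) hκ.le ?_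
    rwa [HSFW.sixth_pow (by positivity)]
  · rw [HSFW.h1sfw_eq]
    exact ⟨hup, hup⟩
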